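/- Let $D$ be an alternating knot diagram (a diagram in the plane or on the sphere with finitely many, numbered crossings and exactly one component; the diagram without crossings is allowed). A Kauffman state $S$ of $D$ is a choice of the $0$-smoothing or the $1$-smoothing at every crossing; $r(D,S)$ denotes the number of $1$-smoothings in $S$. Let $\mathcal A=\mathbb Z[X]/(X^2)$, with $1$ in degree $1$ and $X$ in degree $-1$. Let $\mathcal C(D)$ be the (unnormalized) Khovanov complex of $D$ with integer coefficients, $$\mathcal C(D)=\bigoplus_{S}\mathcal A^{\otimes\{\text{circles of }S\}},$$ where the summand of $S$ has primary degree $r(D,S)$ and its secondary degree is shifted up by $r(D,S)$, and where the differential, of bidegree $(1,0)$, is the signed sum over all replacements of a $0$-smoothing by a $1$-smoothing of the maps given by the multiplication of $\mathcal A$ when two circles merge and by the comultiplication $1\mapsto 1\otimes X+X\otimes 1$, $X\mapsto X\otimes X$ when a circle splits; the sign is $(-1)^m$, with $m$ the number of $1$-smoothings at crossings preceding the one that changes. Let $\mathcal H(D)^{i,j}$ be its homology in bidegree $(i,j)$. There are Kauffman states of $D$ consisting of exactly one circle, and $r(D,S)$ has the same value $n_1(D)$ for all of them. The homology $\mathcal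 H(D)$ is non-zero; let $i_-$ and $i_+$ be the smallest and the largest $i$ such that $\mathcal H(D)^{i,j}\neq 0$ for some $j$. Then $$\mathcal H(D)^{i_-,j_-}\neq 0\ \text{ for } j_-=2i_--n_1(D)-1,\qquad \mathcal H(D)^{i_+,j_+}\neq 0\ \text{ for } j_+=2i_+-n_1(D)+1 .$$ -/

import Mathlib

/-- A planar (unoriented) link diagram with numbered crossings, presented as a combinatorial map on
the sphere (a planar-diagram code).

The crossings are numbered by `Fin n`. At the crossing `c` four half-edges `(c, 0)`, `(c, 1)`,
`(c, 2)`, `(c, 3)` arrive, listed counterclockwise; `(c, 0)` and `(c, 2)` belong to the strand that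
passes under, `(c, 1)` and `(c, 3)` to the strand that passes over. The fixed-point free involution
`edge` sends each half-edge to the other half of its edge. In addition there are `loops` many
circles without crossings on them. -/
structure LinkDiagram where
  /-- the number of crossings -/
  n : ℕ
  /-- the number of components without crossings on them -/
  loops : ℕ
  /-- the other half of the edge to which a half-edge belongs -/
  edge : Fin n × Fin 4 → Fin n × Fin 4
  edge_edge : ∀ d, edge (edge d) = d
  edge_ne : ∀ d, edge d ≠ d
  /-- Planarity by Euler's formula `V + F = E + 2 K`, for the 4-valent graph with `V = n` vertices
  (the crossings) and `E = 2 n` edges. The faces are the orbits of "go to the other end of the edge,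
  then turn to the next half-edge at that crossing", and `K` is the number of connected components
  of the graph. (In general `V - E + F` is the sum of `2 - 2 g` over the connected components, so
  the equality says that each of them has genus `g = 0`.) -/
  planar : n + Nat.card (Quot fun d d' : Fin n × Fin 4 => d' = ((edge d).1, (edge d).2 + 1)) =
    2 * n + 2 * Nat.card (Quot fun d d' : Fin n × Fin 4 => d' = edge d ∨ d'.1 = d.1)

namespace LinkDiagram

/-- The half-edges of a diagram. -/
abbrev Dart (D : LinkDiagram) : Type := Fin D.n × Fin 4

/-- The half-edge opposite to `d` at the same crossing; it belongs to the same strand. -/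
def opp (D : LinkDiagram) (d : D.Dart) : D.Dart := (d.1, d.2 + 2)

/-- Going along the link: arrive at a crossing along the half-edge `d`, go straight through the
crossing, and follow the edge up to the half-edge along which the next crossing is reached. -/
def next (D : LinkDiagram) (d : D.Dart) : D.Dart := D.edge (D.opp d)

/-- The half-edge belongs to the strand that passes over at its crossing. -/
def IsOver (D : LinkDiagram) (d : D.Dart) : Prop := d.2 = 1 ∨ d.2 = 3

/-- The components of the link: the closed curves obtained by following edges and going straight
through crossings, and the circles without crossings. -/
def Component (D : LinkDiagram) : Type :=
  (Quot fun d d' : D.Dart => d' = D.edge d ∨ d' = D.opp d) ⊕ Fin D.loops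

/-- A knot diagram is a link diagram with exactly one component. -/
def IsKnot (D : LinkDiagram) : Prop := Nat.card D.Component = 1

/-- The diagram is alternating: overcrossings and undercrossings alternate as one goes along the
link. -/
def IsAlternating (D : LinkDiagram) : Prop := ∀ d : D.Dart, D.IsOver (D.next d) ↔ ¬ D.IsOver d

/-- A Kauffman state (a choice of the `0`-smoothing or the `1`-smoothing at every crossing), given
as the set of those crossings that get the `1`-smoothing. -/
abbrev State (D : LinkDiagram) : Type := Finset (Fin D.n)

/-- The half-edge at the same crossing to which `d` is joined by the smoothing.
The `0`-smoothing, which connects the two regions swept out when the overstrand is turned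
counterclockwise, joins the half-edges `0, 1` and `2, 3`;
the `1`-smoothing joins `1, 2` and `3, 0`. -/
def smooth (D : LinkDiagram) (S : D.State) (d : D.Dart) : D.Dart :=
  (d.1, if d.1 ∈ S then ![3, 2, 1, 0] d.2 else ![1, 0, 3, 2] d.2)

/-- The circles of a Kauffman state. -/
def Circle (D : LinkDiagram) (S : D.State) : Type :=
  (Quot fun d d' : D.Dart => d' = D.edge d ∨ d' = D.smooth S d) ⊕ Fin D.loops

instance (D : LinkDiagram) (S : D.State) : Finite (D.Circle S) := by
  unfold Circle; infer_instance

/-- The circle of the state `S` that runs through the half-edge `d`. -/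
def circleAt (D : LinkDiagram) (S : D.State) (d : D.Dart) : D.Circle S := Sum.inl (Quot.mk _ d)

/-- The circle of the state `S` given by a component without crossings. -/
def freeCircle (D : LinkDiagram) (S : D.State) (l : Fin D.loops) : D.Circle S := Sum.inr l

/-- The Kauffman states that consist of exactly `k` circles. -/
def statesWith (D : LinkDiagram) (k : ℕ) : Set D.State := {S | Nat.card (D.Circle S) = k}

/-- The standard basis of the Khovanov complex. To the state `S` belongs the tensor power of
`𝒜 = ℤ[X]/(X²)` with one factor for each circle of `S`; the basis element `⟨S, a⟩` is the tensor
product of the elements `X ^ a z` over the circles `z` of `S`, where `a z` is `0` or `1`. -/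
abbrev Gen (D : LinkDiagram) : Type := Σ S : D.State, (D.Circle S → Fin 2)

/-- The primary (homological) degree: the number of `1`-smoothings. -/
def hdeg (D : LinkDiagram) (s : D.Gen) : ℤ := (s.1.card : ℤ)

/-- The secondary degree: `1` has degree `1`, `X` has degree `-1`, degrees add up in tensor
products, and there is a shift by the number of `1`-smoothings. -/
noncomputable def qdeg (D : LinkDiagram) (s : D.Gen) : ℤ :=
  (∑ᶠ z : D.Circle s.1, (1 - 2 * ((s.2 z : ℕ) : ℤ))) + (s.1.card : ℤ)

/-- The label of `s` on the circle through the half-edge `d`, as an exponent of `X`. -/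
def lab (D : LinkDiagram) (s : D.Gen) (d : D.Dart) : ℕ := (s.2 (D.circleAt s.1 d) : ℕ)

/-- The labels of `s` and `t` agree on the circles that do not touch the crossing `c`. -/
def AgreeAway (D : LinkDiagram) (c : Fin D.n) (s t : D.Gen) : Prop :=
  (∀ d : D.Dart, (∀ k : Fin 4, D.circleAt s.1 d ≠ D.circleAt s.1 (c, k)) →
    D.lab s d = D.lab t d) ∧
  ∀ l : Fin D.loops, s.2 (D.freeCircle s.1 l) = t.2 (D.freeCircle t.1 l)

open scoped Classical in
/-- The coefficient of `t` in the image of `s` under the map induced by replacing the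
`0`-smoothing by the `1`-smoothing at `c` (so the state of `t` is that of `s` with `c` added).
If two different circles meet at `c`, they are merged, by the multiplication
`X ^ a ⊗ X ^ b ↦ X ^ (a + b)` of `𝒜` (with `X ^ 2 = 0`); otherwise one circle is split into two,
by the comultiplication `1 ↦ 1 ⊗ X + X ⊗ 1`, `X ↦ X ⊗ X`, i.e. `X ^ a` goes to the sum of the
`X ^ b ⊗ X ^ b'` with `b + b' = a + 1`. The map is the identity on all other factors. -/
noncomputable def edgeCoeff (D : LinkDiagram) (c : Fin D.n) (s t : D.Gen) : ℤ :=
  if D.AgreeAway c s t then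
    if D.circleAt s.1 (c, 0) ≠ D.circleAt s.1 (c, 2) then
      if D.lab s (c, 0) + D.lab s (c, 2) = D.lab t (c, 0) then 1 else 0
    else
      if D.lab t (c, 0) + D.lab t (c, 2) = D.lab s (c, 0) + 1 then 1 else 0
  else 0

/-- The matrix coefficient of the differential from `s` to `t`. The edge of the cube of smoothings
at which the crossing `c` changes carries the sign `(-1) ^ m`, with `m` the number of
`1`-smoothings among the crossings before `c`. -/
noncomputable def dCoeff (D : LinkDiagram) (s t : D.Gen) : ℤ :=
  ∑ c : Fin D.n, if c ∉ s.1 ∧ t.1 = insert c s.1 then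
    (-1) ^ (s.1.filter (fun b => b < c)).card * D.edgeCoeff c s t else 0

/-- The underlying module of the Khovanov complex, with integer coefficients. -/
abbrev Chain (D : LinkDiagram) : Type := D.Gen →₀ ℤ

/-- The differential of the Khovanov complex. -/
noncomputable def d (D : LinkDiagram) : D.Chain →ₗ[ℤ] D.Chain :=
  Finsupp.linearCombination ℤ fun s => Finsupp.equivFunOnFinite.symm (D.dCoeff s)

/-- The homogeneous component of bidegree `(i, j)` of the Khovanov complex. -/
noncomputable def chain (D : LinkDiagram) (i j : ℤ) : Submodule ℤ D.Chain :=
  Finsupp.supported ℤ ℤ {s | D.hdeg s = i ∧ D.qdeg s = j}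

/-- The cycles of bidegree `(i, j)`. -/
noncomputable def cycles (D : LinkDiagram) (i j : ℤ) : Submodule ℤ D.Chain :=
  D.chain i j ⊓ LinearMap.ker D.d

/-- The boundaries of bidegree `(i, j)`; the differential has bidegree `(1, 0)`. -/
noncomputable def boundaries (D : LinkDiagram) (i j : ℤ) : Submodule ℤ D.Chain :=
  (D.chain (i - 1) j).map D.d

/-- Khovanov homology in bidegree `(i, j)`: cycles modulo boundaries. -/
abbrev H (D : LinkDiagram) (i j : ℤ) : Type :=
  D.cycles i j ⧸ (D.boundaries i j).submoduleOf (D.cycles i j)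

/-- The primary degrees in which Khovanov homology is non-zero. -/
def homSupport (D : LinkDiagram) : Set ℤ := {i | ∃ j : ℤ, Nontrivial (D.H i j)}

end LinkDiagram

open Equiv in
theorem sameCycle_pow_mod {α : Type*} {τ : Perm α} {x y : α} [Finite α] {k : ℕ} (hk : 0 < k)
    (hx : (τ ^ k) x = x) (h : τ.SameCycle x y) : ∃ j < k, (τ ^ j) x = y := by
  obtain ⟨i, -, hi⟩ := h.exists_pow_eq'
  refine ⟨i % k, Nat.mod_lt _ hk, ?_⟩
  rw [← hi, ← Equiv.Perm.iterate_eq_pow, ← Equiv.Perm.iterate_eq_pow]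
  refine Function.IsPeriodicPt.iterate_mod_apply ?_ i
  rw [Function.IsPeriodicPt, Function.IsFixedPt, Equiv.Perm.iterate_eq_pow, hx]

open Equiv in
/-- Composing a permutation with the transposition of `a` and `b` joins their cycles if these are
different, and cuts their cycle otherwise. -/
theorem sameCycle_mul_swap_iff {α : Type*} [Finite α] [DecidableEq α] (σ : Perm α) {a b : α}
    (hab : a ≠ b) : (σ * swap a b).SameCycle a b ↔ ¬ σ.SameCycle a b := by
  have hex : ∃ k, 0 < k ∧ ((σ ^ k) b = a ∨ (σ ^ k) b = b) :=
    ⟨orderOf σ, orderOf_pos σ, Or.inr (by rw [pow_orderOf_eq_one]; rfl)⟩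
  classical
  set k := Nat.find hex with hkdef
  obtain ⟨hk0, hk⟩ := Nat.find_spec hex
  have hmin : ∀ j, 0 < j → j < k → (σ ^ j) b ≠ a ∧ (σ ^ j) b ≠ b := fun j h0 hj => by
    have := Nat.find_min hex hj
    push Not at this
    exact this h0
  have hpath : ∀ j, j + 1 ≤ k → ((σ * swap a b) ^ (j + 1)) a = (σ ^ (j + 1)) b := by
    intro j
    induction j with
    | zero => intro _; simp
    | succ j ih =>
      intro hj
      obtain ⟨h1, h2⟩ := hmin (j + 1) (by omega) (by omega)
      rw [pow_succ' _ (j + 1), Perm.mul_apply, ih (by omega), Perm.mul_apply,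
        swap_apply_of_ne_of_ne h1 h2, pow_succ' σ (j + 1), Perm.mul_apply]
  have hpk : ((σ * swap a b) ^ k) a = (σ ^ k) b := by
    obtain ⟨m, hm⟩ : ∃ m, k = m + 1 := ⟨k - 1, by omega⟩
    rw [hm]; exact hpath m (by omega)
  rcases hk with hk | hk
  · have h1 : σ.SameCycle a b := (show σ.SameCycle b a from ⟨k, by simpa using hk⟩).symm
    refine ⟨fun h => ?_, fun h => absurd h1 h⟩
    obtain ⟨j, hj, hjb⟩ := sameCycle_pow_mod hk0 (hpk.trans hk) h
    rcases j with _ | j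
    · exact absurd hjb hab
    · rw [hpath j (by omega)] at hjb
      exact absurd hjb (hmin (j + 1) (by omega) hj).2
  · have h1 : (σ * swap a b).SameCycle a b := ⟨k, by simpa using hpk.trans hk⟩
    refine ⟨fun _ h => ?_, fun _ => h1⟩
    obtain ⟨j, hj, hjb⟩ := sameCycle_pow_mod hk0 hk h.symm
    rcases j with _ | j
    · exact hab hjb.symm
    · exact (hmin (j + 1) (by omega) hj).1 hjb

/-- Sums over two quotients of a type, one of which arises from the other by identifying the
classes of `a` and `b`. -/
theorem finsum_add_of_merge {α β β' : Type*} [Finite β] [Finite β'] {p : α → β} {p' : α → β'}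
    (hp : p.Surjective) (hp' : p'.Surjective) {a b : α} (hab : p a ≠ p b)
    (H : ∀ x y, p' x = p' y ↔
      p x = p y ∨ ((p x = p a ∨ p x = p b) ∧ (p y = p a ∨ p y = p b)))
    (g : β → ℤ) (g' : β' → ℤ) (hg : ∀ x, p x ≠ p a → p x ≠ p b → g (p x) = g' (p' x)) :
    ∑ᶠ z, g z + g' (p' a) = ∑ᶠ z, g' z + g (p a) + g (p b) := by
  classical
  cases nonempty_fintype β
  cases nonempty_fintype β'
  rw [finsum_eq_sum_of_fintype, finsum_eq_sum_of_fintype]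
  have h1 : ∑ z, g z = ∑ z ∈ (Finset.univ.erase (p a)).erase (p b), g z + g (p b) + g (p a) := by
    rw [Finset.sum_erase_add _ _ (by simp [hab.symm]), Finset.sum_erase_add _ _ (by simp)]
  have h2 : ∑ z, g' z = ∑ z ∈ Finset.univ.erase (p' a), g' z + g' (p' a) := by
    rw [Finset.sum_erase_add _ _ (by simp)]
  have h3 : ∑ z ∈ (Finset.univ.erase (p a)).erase (p b), g z
      = ∑ z ∈ Finset.univ.erase (p' a), g' z := by
    have hr : ∀ z, p (Function.surjInv hp z) = z := Function.surjInv_eq hp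
    refine Finset.sum_nbij (fun z => p' (Function.surjInv hp z)) ?_ ?_ ?_ ?_
    · intro z hz
      simp only [Finset.mem_erase, Finset.mem_univ, and_true, ne_eq] at hz ⊢
      rw [H, hr]
      tauto
    · intro z hz w hw h
      simp only [Finset.coe_erase, Finset.coe_univ, Set.mem_sdiff, Set.mem_singleton_iff,
        Set.mem_univ, true_and] at hz hw
      have := (H _ _).1 h
      rw [hr, hr] at this
      tauto
    · intro w hw
      simp only [Finset.coe_erase, Finset.coe_univ, Set.mem_sdiff, Set.mem_singleton_iff,
        Set.mem_univ, true_and, Set.mem_image] at hw ⊢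
      obtain ⟨x, rfl⟩ := hp' w
      rw [H] at hw
      refine ⟨p x, ?_, ?_⟩
      · tauto
      · rw [H, hr]; tauto
    · intro z hz
      simp only [Finset.mem_erase, Finset.mem_univ, and_true, ne_eq] at hz
      have := hg (Function.surjInv hp z) (by rw [hr]; exact hz.2) (by rw [hr]; exact hz.1)
      rwa [hr] at this
  rw [h1, h2, h3]; ring

theorem card_of_merge {α β β' : Type*} [Finite β] [Finite β'] {p : α → β} {p' : α → β'}
    (hp : p.Surjective) (hp' : p'.Surjective) {a b : α} (hab : p a ≠ p b)
    (H : ∀ x y, p' x = p' y ↔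
      p x = p y ∨ ((p x = p a ∨ p x = p b) ∧ (p y = p a ∨ p y = p b))) :
    Nat.card β = Nat.card β' + 1 := by
  have := finsum_add_of_merge hp hp' hab H (fun _ => 1) (fun _ => 1) (fun _ _ _ => rfl)
  cases nonempty_fintype β
  cases nonempty_fintype β'
  simp only [finsum_eq_sum_of_fintype, Finset.sum_const, Finset.card_univ,
    mul_one, nsmul_eq_mul] at this
  rw [Nat.card_eq_fintype_card, Nat.card_eq_fintype_card]
  omega

theorem card_eq_of_fibers {α β β' : Type*} {p : α → β} {p' : α → β'}
    (hp : p.Surjective) (hp' : p'.Surjective) (H : ∀ x y, p' x = p' y ↔ p x = p y) :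
    Nat.card β = Nat.card β' := by
  refine Nat.card_eq_of_bijective (fun z => p' (Function.surjInv hp z)) ⟨fun z w h => ?_, fun w => ?_⟩
  · have := (H _ _).1 h
    rwa [Function.surjInv_eq hp, Function.surjInv_eq hp] at this
  · obtain ⟨x, rfl⟩ := hp' w
    exact ⟨p x, (H _ _).2 (Function.surjInv_eq hp _)⟩

namespace BasedComplex

set_option linter.unusedSectionVars false

variable {G : Type*} [Fintype G]

/-- The differential with matrix `M`, on row vectors. -/
def bd (M : G → G → ℤ) (x : G → ℤ) (t : G) : ℤ := ∑ s, x s * M s t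

/-- The vector is supported on the elements of `Q` of bidegree `(i, j)`. -/
def SuppOn (h q : G → ℤ) (Q : Set G) (i j : ℤ) (x : G → ℤ) : Prop :=
  ∀ s, x s ≠ 0 → s ∈ Q ∧ h s = i ∧ q s = j

/-- The subquotient spanned by `Q` has no homology in bidegree `(i, j)`. -/
def ExactOn (M : G → G → ℤ) (h q : G → ℤ) (Q : Set G) (i j : ℤ) : Prop :=
  ∀ x, SuppOn h q Q i j x → (∀ t ∈ Q, bd M x t = 0) →
    ∃ y, SuppOn h q Q (i - 1) j y ∧ ∀ t ∈ Q, bd M y t = x t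

/-- A set of basis elements spanning a subquotient complex. -/
def Convex (M : G → G → ℤ) (Q : Set G) : Prop :=
  ∀ s ∈ Q, ∀ u ∈ Q, ∀ t, M s t ≠ 0 → M t u ≠ 0 → t ∈ Q

/-- The matrix is a differential of bidegree `(1, 0)`. -/
structure IsDiff (M : G → G → ℤ) (h q : G → ℤ) : Prop where
  sq : ∀ s u, ∑ t, M s t * M t u = 0
  hdeg : ∀ s t, M s t ≠ 0 → h t = h s + 1
  qdeg : ∀ s t, M s t ≠ 0 → q t = q s

variable {M : G → G → ℤ} {h q : G → ℤ} {Q U V : Set G} {i j : ℤ} {x y : G → ℤ}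

theorem bd_add (x y : G → ℤ) (t : G) : bd M (x + y) t = bd M x t + bd M y t := by
  simp only [bd, Pi.add_apply, add_mul, Finset.sum_add_distrib]

theorem bd_sub (x y : G → ℤ) (t : G) : bd M (x - y) t = bd M x t - bd M y t := by
  simp only [bd, Pi.sub_apply, sub_mul, Finset.sum_sub_distrib]

theorem bd_congr {t : G} (H : ∀ s, M s t ≠ 0 → x s = y s) : bd M x t = bd M y t := by
  refine Finset.sum_congr rfl fun s _ => ?_
  by_cases hs : M s t = 0
  · simp [hs]
  · rw [H s hs]

theorem bd_ne_zero {t : G} (H : bd M x t ≠ 0) : ∃ s, x s ≠ 0 ∧ M s t ≠ 0 := by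
  obtain ⟨s, -, hs⟩ := Finset.exists_ne_zero_of_sum_ne_zero H
  exact ⟨s, left_ne_zero_of_mul hs, right_ne_zero_of_mul hs⟩

theorem SuppOn.zero (hx : SuppOn h q Q i j x) {s : G} (hs : s ∉ Q) : x s = 0 := by
  by_contra hne
  exact hs (hx s hne).1

theorem SuppOn.add (hx : SuppOn h q Q i j x) (hy : SuppOn h q Q i j y) :
    SuppOn h q Q i j (x + y) := fun s hs => by
  by_cases h0 : x s = 0
  · exact hy s (by simpa [h0] using hs)
  · exact hx s h0

theorem SuppOn.sub (hx : SuppOn h q Q i j x) (hy : SuppOn h q Q i j y) :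
    SuppOn h q Q i j (x - y) := fun s hs => by
  by_cases h0 : x s = 0
  · exact hy s (by simpa [h0] using hs)
  · exact hx s h0

theorem SuppOn.mono (hx : SuppOn h q U i j x) (hUQ : U ⊆ Q) : SuppOn h q Q i j x :=
  fun s hs => ⟨hUQ (hx s hs).1, (hx s hs).2⟩

theorem SuppOn.indicator (hx : SuppOn h q Q i j x) (U : Set G) :
    SuppOn h q U i j (U.indicator x) := fun s hs => by
  have hU := Set.mem_of_indicator_ne_zero hs
  rw [Set.indicator_of_mem hU] at hs
  exact ⟨hU, (hx s hs).2⟩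

theorem SuppOn.bd (hM : IsDiff M h q) (hx : SuppOn h q Q i j x) :
    SuppOn h q Set.univ (i + 1) j (bd M x) := fun t ht => by
  obtain ⟨s, hs, hst⟩ := bd_ne_zero ht
  obtain ⟨-, h1, h2⟩ := hx s hs
  exact ⟨trivial, by rw [hM.hdeg s t hst, h1], by rw [hM.qdeg s t hst, h2]⟩

theorem bd_bd (hM : IsDiff M h q) (x : G → ℤ) (u : G) : bd M (bd M x) u = 0 := by
  simp only [bd, Finset.sum_mul]
  rw [Finset.sum_comm]
  refine Finset.sum_eq_zero fun s _ => ?_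
  simp only [mul_assoc]
  rw [← Finset.mul_sum, hM.sq, mul_zero]

theorem bd_indicator_bd (hM : IsDiff M h q) (hQ : Convex M Q) (hx : SuppOn h q Q i j x) {u : G}
    (hu : u ∈ Q) : bd M (Q.indicator (bd M x)) u = 0 := by
  rw [← bd_bd hM x u]
  have : ∀ t ∉ Q, bd M x t * M t u = 0 := fun t ht => by
    by_contra hne
    obtain ⟨s, hs, hst⟩ := bd_ne_zero (left_ne_zero_of_mul hne)
    exact ht (hQ s (hx s hs).1 u hu t hst (right_ne_zero_of_mul hne))
  refine Finset.sum_congr rfl fun t _ => ?_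
  by_cases ht : t ∈ Q
  · rw [Set.indicator_of_mem ht]
  · rw [Set.indicator_of_notMem ht, this t ht, zero_mul]

/-- The subquotient spanned by `Q` is an extension of that spanned by `V` by that spanned
by `U`. -/
structure Splits (M : G → G → ℤ) (Q U V : Set G) : Prop where
  convex : Convex M Q
  union : Q = U ∪ V
  disj : Disjoint U V
  zero : ∀ u ∈ U, ∀ v ∈ V, M u v = 0

namespace Splits

variable (H : Splits M Q U V)
include H

theorem left_subset : U ⊆ Q := by rw [H.union]; exact Set.subset_union_left
theorem right_subset : V ⊆ Q := by rw [H.union]; exact Set.subset_union_right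

theorem notMem_right {s : G} (hs : s ∈ U) : s ∉ V := fun h' => Set.disjoint_left.1 H.disj hs h'

theorem convex_left : Convex M U := fun s hs u hu t h1 h2 => by
  have := H.convex s (H.left_subset hs) u (H.left_subset hu) t h1 h2
  rw [H.union] at this
  exact this.resolve_right fun ht => h1 (H.zero s hs t ht)

theorem convex_right : Convex M V := fun s hs u hu t h1 h2 => by
  have := H.convex s (H.right_subset hs) u (H.right_subset hu) t h1 h2
  rw [H.union] at this
  exact this.resolve_left fun ht => h2 (H.zero t ht u hu)

theorem bd_eq_zero (hx : SuppOn h q U i j x) {t : G} (ht : t ∈ V) : bd M x t = 0 := by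
  by_contra hne
  obtain ⟨s, hs, hst⟩ := bd_ne_zero hne
  exact hst (H.zero s (hx s hs).1 t ht)

theorem bd_indicator_right (hx : SuppOn h q Q i j x) {t : G} (ht : t ∈ V) :
    bd M (V.indicator x) t = bd M x t := by
  refine bd_congr fun s hs => ?_
  by_cases hV : s ∈ V
  · rw [Set.indicator_of_mem hV]
  · rw [Set.indicator_of_notMem hV, hx.zero]
    intro hQ
    rw [H.union] at hQ
    exact hs (H.zero s (hQ.resolve_right hV) t ht)

/-- Exactness in the middle of the long exact sequence. -/
theorem exactOn (hM : IsDiff M h q) (hU : ExactOn M h q U i j) (hV : ExactOn M h q V i j) :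
    ExactOn M h q Q i j := by
  intro x hx hdx
  obtain ⟨y, hy, hyx⟩ := hV (V.indicator x) (hx.indicator V) fun t ht => by
    rw [H.bd_indicator_right hx ht, hdx t (H.right_subset ht)]
  have hyQ := hy.mono H.right_subset
  have e : U.indicator (x - bd M y) = x - Q.indicator (bd M y) := by
    funext s
    by_cases hU : s ∈ U
    · simp [hU, H.left_subset hU]
    · by_cases hV : s ∈ V
      · simp [hU, H.right_subset hV, hyx s hV, hV]
      · have hQ : s ∉ Q := by rw [H.union]; simp [hU, hV]
        simp [hU, hQ, hx.zero hQ]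
  have hb := (hy.bd hM)
  rw [sub_add_cancel] at hb
  have hs : SuppOn h q U i j (U.indicator (x - bd M y)) :=
    ((hx.mono (Set.subset_univ Q)).sub hb).indicator U
  obtain ⟨w, hw, hwx⟩ := hU _ hs fun t ht => by
    rw [e, bd_sub, hdx t (H.left_subset ht),
      bd_indicator_bd hM H.convex hyQ (H.left_subset ht), sub_zero]
  refine ⟨w + y, (hw.mono H.left_subset).add hyQ, fun t ht => ?_⟩
  rw [bd_add]
  rw [H.union] at ht
  rcases ht with ht | ht
  · rw [hwx t ht, Set.indicator_of_mem ht, Pi.sub_apply, sub_add_cancel]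
  · rw [H.bd_eq_zero hw ht, hyx t ht, Set.indicator_of_mem ht, zero_add]

theorem exactOn_left (hM : IsDiff M h q) (hQ : ExactOn M h q Q i j)
    (hV : ExactOn M h q V (i - 1) j) : ExactOn M h q U i j := by
  intro x hx hdx
  obtain ⟨y, hy, hyx⟩ := hQ x (hx.mono H.left_subset) fun t ht => by
    rw [H.union] at ht
    rcases ht with ht | ht
    · exact hdx t ht
    · exact H.bd_eq_zero hx ht
  obtain ⟨w, hw, hwy⟩ := hV (V.indicator y) (hy.indicator V) fun t ht => by
    rw [H.bd_indicator_right hy ht, hyx t (H.right_subset ht),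
      hx.zero fun h' => H.notMem_right h' ht]
  have hwQ := hw.mono H.right_subset
  have e : U.indicator (y - bd M w) = y - Q.indicator (bd M w) := by
    funext s
    by_cases hU : s ∈ U
    · simp [hU, H.left_subset hU]
    · by_cases hV : s ∈ V
      · simp [hU, H.right_subset hV, hwy s hV, hV]
      · have hQ : s ∉ Q := by rw [H.union]; simp [hU, hV]
        simp [hU, hQ, hy.zero hQ]
  have hb := (hw.bd hM)
  rw [sub_add_cancel] at hb
  refine ⟨U.indicator (y - bd M w), ((hy.mono (Set.subset_univ Q)).sub hb).indicator U,
    fun t ht => ?_⟩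
  rw [e, bd_sub, hyx t (H.left_subset ht), bd_indicator_bd hM H.convex hwQ (H.left_subset ht),
    sub_zero]

theorem exactOn_right (hM : IsDiff M h q) (hQ : ExactOn M h q Q i j)
    (hU : ExactOn M h q U (i + 1) j) : ExactOn M h q V i j := by
  intro x hx hdx
  have hxQ := hx.mono H.right_subset
  have e : U.indicator (bd M x) = Q.indicator (bd M x) := by
    funext s
    by_cases hU : s ∈ U
    · simp [hU, H.left_subset hU]
    · by_cases hV : s ∈ V
      · simp [hU, H.right_subset hV, hdx s hV]
      · have hQ : s ∉ Q := by rw [H.union]; simp [hU, hV]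
        simp [hU, hQ]
  obtain ⟨w, hw, hwx⟩ := hU (U.indicator (bd M x)) ((hx.bd hM).indicator U) fun t ht => by
    rw [e, bd_indicator_bd hM H.convex hxQ (H.left_subset ht)]
  rw [add_sub_cancel_right] at hw
  obtain ⟨y, hy, hyx⟩ := hQ (x - w) (hxQ.sub (hw.mono H.left_subset)) fun t ht => by
    rw [bd_sub]
    rw [H.union] at ht
    rcases ht with ht | ht
    · rw [hwx t ht, Set.indicator_of_mem ht, sub_self]
    · rw [hdx t ht, H.bd_eq_zero hw ht, sub_self]
  refine ⟨V.indicator y, hy.indicator V, fun t ht => ?_⟩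
  rw [H.bd_indicator_right hy ht, hyx t (H.right_subset ht), Pi.sub_apply,
    hw.zero fun h' => H.notMem_right h' ht, sub_zero]

theorem exactOn_iff_right (hM : IsDiff M h q) (hU : ∀ i j, ExactOn M h q U i j) :
    ExactOn M h q Q i j ↔ ExactOn M h q V i j :=
  ⟨fun hQ => H.exactOn_right hM hQ (hU _ _), fun hV => H.exactOn hM (hU _ _) hV⟩

theorem exactOn_iff_left (hM : IsDiff M h q) (hV : ∀ i j, ExactOn M h q V i j) :
    ExactOn M h q Q i j ↔ ExactOn M h q U i j :=
  ⟨fun hQ => H.exactOn_left hM hQ (hV _ _), fun hU => H.exactOn hM hU (hV _ _)⟩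

/-- The cone of an isomorphism that permutes the basis up to signs is acyclic. -/
theorem exactOn_of_matching (hM : IsDiff M h q)
    (hs : ∀ s ∈ V, ∃ t ∈ U, M s t ≠ 0 ∧ ∀ s' ∈ V, s' ≠ s → M s' t = 0)
    (ht : ∀ t ∈ U, ∃ s ∈ V, M s t * M s t = 1 ∧ ∀ t' ∈ U, t' ≠ t → M s t' = 0) (i j : ℤ) :
    ExactOn M h q Q i j := by
  classical
  have inj : ∀ x, (∀ s, x s ≠ 0 → s ∈ V) → (∀ t ∈ U, bd M x t = 0) → ∀ s, x s = 0 := by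
    intro x hx hdx s
    by_contra hne
    obtain ⟨t, htU, hst, huniq⟩ := hs s (hx s hne)
    have h1 := hdx t htU
    rw [bd, Finset.sum_eq_single s] at h1
    · exact mul_ne_zero hne hst h1
    · intro s' _ hs'
      by_cases hs'V : x s' = 0
      · rw [hs'V, zero_mul]
      · rw [huniq s' (hx s' hs'V) hs', mul_zero]
    · simp
  intro x hx hdx
  choose! φ hφV hφ1 hφ0 using ht
  let y : G → ℤ := fun s => ∑ t ∈ Finset.univ.filter (fun t => t ∈ U ∧ φ t = s), x t * M s t
  have hy : SuppOn h q V (i - 1) j y := by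
    intro s hs
    obtain ⟨t, ht, hne⟩ := Finset.exists_ne_zero_of_sum_ne_zero hs
    simp only [Finset.mem_filter, Finset.mem_univ, true_and] at ht
    obtain ⟨htU, rfl⟩ := ht
    obtain ⟨-, h1, h2⟩ := hx t (left_ne_zero_of_mul hne)
    have h3 := hM.hdeg _ _ (right_ne_zero_of_mul hne)
    have h4 := hM.qdeg _ _ (right_ne_zero_of_mul hne)
    exact ⟨hφV t htU, by omega, by omega⟩
  have hyb : ∀ t ∈ U, bd M y t = x t := by
    intro t ht
    rw [bd, Finset.sum_eq_single (φ t)]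
    · have : Finset.univ.filter (fun t' => t' ∈ U ∧ φ t' = φ t) = {t} := by
        ext t'
        simp only [Finset.mem_filter, Finset.mem_univ, true_and, Finset.mem_singleton]
        refine ⟨fun ⟨h1, h2⟩ => ?_, fun h' => by subst h'; exact ⟨ht, rfl⟩⟩
        by_contra hne
        have := hφ0 t ht t' h1 hne
        rw [← h2] at this
        have h3 := hφ1 t' h1
        rw [this] at h3
        simp at h3
      simp only [y, this, Finset.sum_singleton]
      rw [mul_assoc, hφ1 t ht, mul_one]
    · intro s _ hs
      simp only [y, Finset.sum_mul]
      refine Finset.sum_eq_zero fun t' ht' => ?_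
      simp only [Finset.mem_filter, Finset.mem_univ, true_and] at ht'
      obtain ⟨h1, rfl⟩ := ht'
      have : t ≠ t' := fun h' => hs (by rw [h'])
      rw [hφ0 t' h1 t ht this, mul_zero]
    · simp
  have hyQ := hy.mono H.right_subset
  refine ⟨y, hyQ, ?_⟩
  have hb := hy.bd hM
  rw [sub_add_cancel] at hb
  have h0 : ∀ s, (x - Q.indicator (bd M y)) s = 0 := by
    refine inj _ (fun s hs => ?_) fun t ht => ?_
    · by_contra hV
      apply hs
      by_cases hQ : s ∈ Q
      · have hU : s ∈ U := by rw [H.union] at hQ; exact hQ.resolve_right hV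
        simp [hQ, hyb s hU]
      · simp [hQ, hx.zero hQ]
    · rw [bd_sub, hdx t (H.left_subset ht),
        bd_indicator_bd hM H.convex hyQ (H.left_subset ht), sub_zero]
  intro t ht
  have := h0 t
  rw [Pi.sub_apply, Set.indicator_of_mem ht] at this
  omega

end Splits

/-- Exactness is transported along a bijection of basis elements that respects the matrix up to
signs. -/
theorem ExactOn.of_equiv {Q' : Set G} {i' j' a b : ℤ} (φ ψ : G → G) (ε : G → ℤ)
    (hφ : ∀ s ∈ Q, φ s ∈ Q' ∧ ψ (φ s) = s) (hψ : ∀ t ∈ Q', ψ t ∈ Q ∧ φ (ψ t) = t)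
    (hε : ∀ s, ε s * ε s = 1)
    (hMφ : ∀ s ∈ Q, ∀ t ∈ Q, M s t = ε s * ε t * M (φ s) (φ t))
    (hh : ∀ s ∈ Q, h (φ s) = h s + a) (hq : ∀ s ∈ Q, q (φ s) = q s + b)
    (hi : i' = i + a) (hj : j' = j + b)
    (H : ExactOn M h q Q i j) : ExactOn M h q Q' i' j' := by
  classical
  have key : ∀ (x : G → ℤ) (i : ℤ), SuppOn h q Q' (i + a) j' x →
      SuppOn h q Q i j (Q.indicator fun s => ε s * x (φ s)) := by
    intro x i hx s hs
    have hsQ := Set.mem_of_indicator_ne_zero hs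
    rw [Set.indicator_of_mem hsQ] at hs
    obtain ⟨-, h1, h2⟩ := hx _ (right_ne_zero_of_mul hs)
    rw [hh s hsQ] at h1
    rw [hq s hsQ] at h2
    exact ⟨hsQ, by omega, by omega⟩
  have kbd : ∀ (x : G → ℤ), (∀ s, x s ≠ 0 → s ∈ Q') → ∀ t ∈ Q,
      bd M (Q.indicator fun s => ε s * x (φ s)) t = ε t * bd M x (φ t) := by
    intro x hx t ht
    have e1 : bd M (Q.indicator fun s => ε s * x (φ s)) t
        = ∑ s ∈ Finset.univ.filter (· ∈ Q), ε s * x (φ s) * M s t := by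
      rw [bd, Finset.sum_filter]
      refine Finset.sum_congr rfl fun s _ => ?_
      by_cases hs : s ∈ Q <;> simp [hs]
    have e2 : bd M x (φ t) = ∑ s ∈ Finset.univ.filter (· ∈ Q'), x s * M s (φ t) := by
      rw [bd, Finset.sum_filter]
      refine Finset.sum_congr rfl fun s _ => ?_
      by_cases hs : s ∈ Q'
      · simp [hs]
      · have : x s = 0 := by by_contra hne; exact hs (hx s hne)
        simp [hs, this]
    rw [e1, e2, Finset.mul_sum]
    refine Finset.sum_nbij' φ ψ ?_ ?_ ?_ ?_ ?_
    · intro s hs; simpa using (hφ s (by simpa using hs)).1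
    · intro s hs; simpa using (hψ s (by simpa using hs)).1
    · intro s hs; exact (hφ s (by simpa using hs)).2
    · intro s hs; exact (hψ s (by simpa using hs)).2
    · intro s hs
      rw [hMφ s (by simpa using hs) t ht]
      linear_combination (ε t * x (φ s) * M (φ s) (φ t)) * hε s
  intro x hx hdx
  subst hi
  obtain ⟨y, hy, hyx⟩ := H _ (key x i hx) fun t ht => by
    rw [kbd x (fun s hs => (hx s hs).1) t ht, hdx _ (hφ t ht).1, mul_zero]
  refine ⟨Q'.indicator fun t => ε (ψ t) * y (ψ t), ?_, ?_⟩
  · intro t ht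
    have htQ := Set.mem_of_indicator_ne_zero ht
    rw [Set.indicator_of_mem htQ] at ht
    obtain ⟨h0, h1, h2⟩ := hy _ (right_ne_zero_of_mul ht)
    have h3 := hh _ h0
    have h4 := hq _ h0
    rw [(hψ t htQ).2] at h3 h4
    exact ⟨htQ, by omega, by omega⟩
  · intro t ht
    have hback : (Q.indicator fun s => ε s *
        (Q'.indicator fun t => ε (ψ t) * y (ψ t)) (φ s)) = y := by
      funext s
      by_cases hs : s ∈ Q
      · rw [Set.indicator_of_mem hs, Set.indicator_of_mem (hφ s hs).1, (hφ s hs).2]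
        linear_combination y s * hε s
      · rw [Set.indicator_of_notMem hs, hy.zero hs]
    have h1 := kbd (Q'.indicator fun t => ε (ψ t) * y (ψ t))
      (fun s hs => Set.mem_of_indicator_ne_zero hs) (ψ t) (hψ t ht).1
    rw [hback, hyx _ (hψ t ht).1, Set.indicator_of_mem (hψ t ht).1, (hψ t ht).2] at h1
    have h2 := hε (ψ t)
    calc _ = ε (ψ t) * ε (ψ t) * bd M (Q'.indicator fun t => ε (ψ t) * y (ψ t)) t := by
          rw [h2, one_mul]
      _ = ε (ψ t) * (ε (ψ t) * x t) := by rw [h1, mul_assoc]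
      _ = x t := by rw [← mul_assoc, h2, one_mul]

end BasedComplex

namespace LinkDiagram

variable {D : LinkDiagram} {S S' : D.State} {c : Fin D.n}

/-- The two half-edges lie on the same circle of the state. -/
def Conn (D : LinkDiagram) (S : D.State) (d d' : D.Dart) : Prop :=
  D.circleAt S d = D.circleAt S d'

theorem Conn.refl (d : D.Dart) : D.Conn S d d := rfl
theorem Conn.symm {d d' : D.Dart} (h : D.Conn S d d') : D.Conn S d' d := Eq.symm h
theorem Conn.trans {d d' d'' : D.Dart} (h : D.Conn S d d') (h' : D.Conn S d' d'') :
    D.Conn S d d'' := Eq.trans h h'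
theorem conn_comm {d d' : D.Dart} : D.Conn S d d' ↔ D.Conn S d' d := ⟨Conn.symm, Conn.symm⟩

theorem conn_edge (d : D.Dart) : D.Conn S d (D.edge d) :=
  congrArg Sum.inl (Quot.sound (Or.inl rfl))

theorem conn_smooth (d : D.Dart) : D.Conn S d (D.smooth S d) :=
  congrArg Sum.inl (Quot.sound (Or.inr rfl))

theorem Conn.rec_on {r : D.Dart → D.Dart → Prop} (hr : Equivalence r)
    (he : ∀ d, r d (D.edge d)) (hs : ∀ d, r d (D.smooth S d)) {d d' : D.Dart}
    (h : D.Conn S d d') : r d d' := by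
  have h1 := Quot.eqvGen_exact (Sum.inl_injective h)
  clear h
  induction h1 with
  | rel x y h =>
    rcases h with rfl | rfl
    · exact he x
    · exact hs x
  | refl x => exact hr.refl x
  | symm x y _ ih => exact hr.symm ih
  | trans x y z _ _ ih1 ih2 => exact hr.trans ih1 ih2

theorem smooth_smooth (S : D.State) (d : D.Dart) : D.smooth S (D.smooth S d) = d := by
  obtain ⟨c, k⟩ := d
  by_cases hc : c ∈ S <;> fin_cases k <;> simp [smooth, hc]

theorem smooth_congr {d : D.Dart} (h : d.1 ∈ S ↔ d.1 ∈ S') : D.smooth S d = D.smooth S' d := by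
  unfold smooth
  simp only [h]

theorem conn_zero_or_two (S : D.State) (c : Fin D.n) (k : Fin 4) :
    D.Conn S (c, k) (c, 0) ∨ D.Conn S (c, k) (c, 2) := by
  have h0 := conn_smooth (D := D) (S := S) (c, 0)
  have h2 := conn_smooth (D := D) (S := S) (c, 2)
  by_cases hc : c ∈ S <;> simp only [smooth, hc, if_true, if_false] at h0 h2 <;>
    fin_cases k
  · exact Or.inl (Conn.refl _)
  · exact Or.inr h2.symm
  · exact Or.inr (Conn.refl _)
  · exact Or.inl h0.symm
  · exact Or.inl (Conn.refl _)
  · exact Or.inl h0.symm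
  · exact Or.inr (Conn.refl _)
  · exact Or.inr h2.symm

/-- The circle through the half-edge touches the crossing. -/
def Near (D : LinkDiagram) (S : D.State) (c : Fin D.n) (d : D.Dart) : Prop :=
  D.Conn S d (c, 0) ∨ D.Conn S d (c, 2)

theorem near_iff {d : D.Dart} : D.Near S c d ↔ ∃ k, D.Conn S d (c, k) := by
  refine ⟨?_, ?_⟩
  · rintro (h | h)
    exacts [⟨_, h⟩, ⟨_, h⟩]
  · rintro ⟨k, h⟩
    rcases conn_zero_or_two S c k with hk | hk
    exacts [Or.inl (h.trans hk), Or.inr (h.trans hk)]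

theorem Near.of_conn {d d' : D.Dart} (h : D.Near S c d) (h' : D.Conn S d' d) :
    D.Near S c d' := h.imp h'.trans h'.trans

theorem near_self (k : Fin 4) : D.Near S c (c, k) := conn_zero_or_two S c k

/-- The relation obtained by joining all circles that touch a crossing. -/
theorem equivalence_join (S : D.State) (c : Fin D.n) :
    Equivalence fun d d' => D.Conn S d d' ∨ (D.Near S c d ∧ D.Near S c d') where
  refl d := Or.inl (Conn.refl d)
  symm := by
    rintro d d' (h | ⟨h, h'⟩)
    exacts [Or.inl h.symm, Or.inr ⟨h', h⟩]
  trans := by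
    rintro d d' d'' (h | ⟨h, h'⟩) (g | ⟨g, g'⟩)
    · exact Or.inl (h.trans g)
    · exact Or.inr ⟨g.of_conn h, g'⟩
    · exact Or.inr ⟨h, h'.of_conn g.symm⟩
    · exact Or.inr ⟨h, g'⟩

theorem Conn.join (hS : ∀ x ≠ c, x ∈ S ↔ x ∈ S') {d d' : D.Dart} (h : D.Conn S d d') :
    D.Conn S' d d' ∨ (D.Near S' c d ∧ D.Near S' c d') := by
  refine Conn.rec_on (equivalence_join S' c) (fun d => Or.inl (conn_edge d)) (fun d => ?_) h
  obtain ⟨x, k⟩ := d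
  by_cases hx : x = c
  · subst hx
    exact Or.inr ⟨near_self k, near_self _⟩
  · rw [smooth_congr (S' := S') (hS x hx)]
    exact Or.inl (conn_smooth _)

theorem Near.toggle (hS : ∀ x ≠ c, x ∈ S ↔ x ∈ S') {d : D.Dart} (h : D.Near S c d) :
    D.Near S' c d := by
  rcases h with h | h <;> rcases h.join hS with h | ⟨h, -⟩
  exacts [Or.inl h, h, Or.inr h, h]

theorem near_toggle_iff (hS : ∀ x ≠ c, x ∈ S ↔ x ∈ S') {d : D.Dart} :
    D.Near S c d ↔ D.Near S' c d :=
  ⟨Near.toggle hS, Near.toggle fun x hx => (hS x hx).symm⟩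

/-- If the two strands at a crossing lie on the same circle in `S'`, then the circles of `S'` arise
from those of `S` by joining the circles that touch the crossing. -/
theorem conn_iff_of_joined (hS : ∀ x ≠ c, x ∈ S ↔ x ∈ S') (h02 : D.Conn S' (c, 0) (c, 2))
    {d d' : D.Dart} :
    D.Conn S' d d' ↔ D.Conn S d d' ∨ (D.Near S c d ∧ D.Near S c d') := by
  refine ⟨Conn.join fun x hx => (hS x hx).symm, ?_⟩
  have key : ∀ d, D.Near S c d → D.Conn S' d (c, 0) := fun d hd =>
    (hd.toggle hS).elim id fun h => h.trans h02.symm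
  rintro (h | ⟨h, h'⟩)
  · rcases h.join hS with h | ⟨h, h'⟩
    · exact h
    · rw [← near_toggle_iff hS] at h h'
      exact (key d h).trans (key d' h').symm
  · exact (key d h).trans (key d' h').symm

/-- A circle that does not touch the crossings at which two states differ is common to both. -/
theorem conn_iff_of_agree {d : D.Dart} (H : ∀ d', D.Conn S d d' → (d'.1 ∈ S ↔ d'.1 ∈ S'))
    (d' : D.Dart) : D.Conn S d d' ↔ D.Conn S' d d' := by
  constructor
  · intro h
    have hr : Equivalence fun x y => (D.Conn S d x ↔ D.Conn S d y) ∧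
        (D.Conn S d x → D.Conn S' x y) :=
      ⟨fun x => ⟨Iff.rfl, fun _ => Conn.refl x⟩,
        fun h => ⟨h.1.symm, fun hx => (h.2 (h.1.2 hx)).symm⟩,
        fun h g => ⟨h.1.trans g.1, fun hx => (h.2 hx).trans (g.2 (h.1.1 hx))⟩⟩
    refine (Conn.rec_on hr (fun x => ⟨?_, fun _ => conn_edge x⟩) (fun x => ⟨?_, fun hx => ?_⟩) h).2
      (Conn.refl d)
    · exact ⟨fun h => h.trans (conn_edge x), fun h => h.trans (conn_edge x).symm⟩
    · exact ⟨fun h => h.trans (conn_smooth x), fun h => h.trans (conn_smooth x).symm⟩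
    · rw [smooth_congr (H x hx)]
      exact conn_smooth x
  · intro h
    have hr : Equivalence fun x y => D.Conn S d x ↔ D.Conn S d y :=
      ⟨fun x => Iff.rfl, Iff.symm, Iff.trans⟩
    refine (Conn.rec_on hr (fun x => ?_) (fun x => ?_) h).1 (Conn.refl d)
    · exact ⟨fun h => h.trans (conn_edge x), fun h => h.trans (conn_edge x).symm⟩
    · constructor
      · intro hx
        rw [← smooth_congr (H x hx)]
        exact hx.trans (conn_smooth x)
      · intro hx
        have h1 := smooth_congr (H _ hx)
        rw [smooth_smooth] at h1
        have h2 := hx.trans (conn_smooth _)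
        rwa [h1] at h2

section Alternating

theorem not_isOver_iff {d : D.Dart} : ¬ D.IsOver d ↔ d.2 = 0 ∨ d.2 = 2 := by
  obtain ⟨c, k⟩ := d
  fin_cases k <;> simp [IsOver]

theorem isOver_smooth (S : D.State) (d : D.Dart) : D.IsOver (D.smooth S d) ↔ ¬ D.IsOver d := by
  obtain ⟨c, k⟩ := d
  by_cases hc : c ∈ S <;> fin_cases k <;> simp [IsOver, smooth, hc]

theorem IsAlternating.isOver_edge (halt : D.IsAlternating) (d : D.Dart) :
    D.IsOver (D.edge d) ↔ ¬ D.IsOver d := by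
  have h := halt (D.opp d)
  obtain ⟨c, k⟩ := d
  fin_cases k <;> simpa [next, opp, IsOver] using h

/-- Follow the smoothing at a crossing, then the edge. -/
def walk (D : LinkDiagram) (S : D.State) : Equiv.Perm D.Dart :=
  (⟨D.smooth S, D.smooth S, smooth_smooth S, smooth_smooth S⟩ : Equiv.Perm D.Dart).trans
    ⟨D.edge, D.edge, D.edge_edge, D.edge_edge⟩

theorem walk_apply (S : D.State) (d : D.Dart) : D.walk S d = D.edge (D.smooth S d) := rfl

theorem IsAlternating.isOver_walk (halt : D.IsAlternating) (S : D.State) (d : D.Dart) :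
    D.IsOver (D.walk S d) ↔ D.IsOver d := by
  rw [walk_apply, halt.isOver_edge, isOver_smooth, not_not]

/-- The half-edges of the strands that pass under. -/
abbrev UnderDart (D : LinkDiagram) : Type := {d : D.Dart // ¬ D.IsOver d}

/-- In an alternating diagram, walking along the circles of a state permutes the half-edges of the
strands that pass under. -/
def underWalk (halt : D.IsAlternating) (S : D.State) : Equiv.Perm D.UnderDart :=
  (D.walk S).subtypePerm fun d => by simp only [halt.isOver_walk]

theorem conn_iff_sameCycle (halt : D.IsAlternating) (S : D.State) (d d' : D.UnderDart) :
    D.Conn S d d' ↔ (underWalk halt S).SameCycle d d' := by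
  classical
  constructor
  · intro h
    let E : D.Dart → D.UnderDart := fun d => if hd : D.IsOver d then
      ⟨D.edge d, by rw [halt.isOver_edge, not_not]; exact hd⟩ else ⟨d, hd⟩
    have hE : ∀ d : D.UnderDart, E d = d := fun d => by simp [E, d.2]
    have hr : Equivalence fun x y => (underWalk halt S).SameCycle (E x) (E y) :=
      ⟨fun x => Equiv.Perm.SameCycle.refl _ _, fun h => h.symm, fun h g => h.trans g⟩
    have := Conn.rec_on hr (fun x => ?_) (fun x => ?_) h
    · simpa only [hE] using this
    · have : E (D.edge x) = E x := by
        by_cases hx : D.IsOver x <;> simp [E, halt.isOver_edge, hx, D.edge_edge]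
      rw [this]
    · by_cases hx : D.IsOver x
      · have h1 : E (D.smooth S x) = ⟨D.smooth S x, by rw [isOver_smooth, not_not]; exact hx⟩ := by
          simp [E, isOver_smooth, hx]
        have h2 : underWalk halt S (E (D.smooth S x)) = E x := by
          rw [h1]
          simp [underWalk, walk_apply, smooth_smooth, E, hx]
        exact Equiv.Perm.SameCycle.symm ⟨1, by simpa using h2⟩
      · have h2 : underWalk halt S (E x) = E (D.smooth S x) := by
          simp [underWalk, walk_apply, E, hx, isOver_smooth]
        exact ⟨1, by simpa using h2⟩
  · rintro ⟨i, rfl⟩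
    induction i with
    | zero => exact Conn.refl _
    | succ i ih =>
      refine ih.trans ?_
      rw [add_comm, zpow_add, zpow_one, Equiv.Perm.mul_apply]
      exact (conn_smooth _).trans (conn_edge _)
    | pred i ih =>
      refine ih.trans ?_
      have : (underWalk halt S ^ (-(i : ℤ))) d
          = underWalk halt S ((underWalk halt S ^ (-(i : ℤ) - 1)) d) := by
        rw [← Equiv.Perm.mul_apply, ← zpow_one_add]; congr 2; ring
      rw [this]
      exact ((conn_smooth _).trans (conn_edge _)).symm

theorem underWalk_insert (halt : D.IsAlternating) (hc : c ∉ S) :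
    underWalk halt (insert c S) = underWalk halt S *
      Equiv.swap ⟨(c, 0), by simp [IsOver]⟩ ⟨(c, 2), by simp [IsOver]⟩ := by
  ext1 d
  apply Subtype.ext
  obtain ⟨⟨x, k⟩, hd⟩ := d
  rw [Equiv.Perm.mul_apply]
  by_cases hx : x = c
  · subst hx
    rcases not_isOver_iff.1 hd with h | h <;> simp only at h <;> subst h
    · rw [Equiv.swap_apply_left]
      simp [underWalk, walk_apply, smooth, hc]
    · rw [Equiv.swap_apply_right]
      simp [underWalk, walk_apply, smooth, hc]
  · rw [Equiv.swap_apply_of_ne_of_ne]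
    · simp [underWalk, walk_apply, smooth, hx]
    · intro h; exact hx (congrArg (fun d : D.UnderDart => d.1.1) h)
    · intro h; exact hx (congrArg (fun d : D.UnderDart => d.1.1) h)

/-- Changing the smoothing at a crossing either joins two circles or cuts a circle. -/
theorem IsAlternating.conn_insert_iff (halt : D.IsAlternating) (hc : c ∉ S) :
    D.Conn (insert c S) (c, 0) (c, 2) ↔ ¬ D.Conn S (c, 0) (c, 2) := by
  have h1 := conn_iff_sameCycle halt (insert c S) ⟨(c, 0), by simp [IsOver]⟩
    ⟨(c, 2), by simp [IsOver]⟩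
  have h2 := conn_iff_sameCycle halt S ⟨(c, 0), by simp [IsOver]⟩ ⟨(c, 2), by simp [IsOver]⟩
  rw [underWalk_insert halt hc, sameCycle_mul_swap_iff _ (by simp)] at h1
  rw [h1, h2]

end Alternating

theorem toggle_insert (c : Fin D.n) (S : D.State) : ∀ x ≠ c, x ∈ S ↔ x ∈ insert c S := by
  intro x hx; simp [hx]

theorem toggle_insert' (c : Fin D.n) (S : D.State) : ∀ x ≠ c, x ∈ insert c S ↔ x ∈ S := by
  intro x hx; simp [hx]

theorem circleAt_surjective (hl : D.loops = 0) (S : D.State) :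
    Function.Surjective (D.circleAt S) := by
  rintro (z | l)
  · obtain ⟨d, rfl⟩ := Quot.exists_rep z
    exact ⟨d, rfl⟩
  · exact (Fin.cast hl l).elim0

theorem card_circle_of_joined (hl : D.loops = 0) (hS : ∀ x ≠ c, x ∈ S ↔ x ∈ S')
    (h : ¬ D.Conn S (c, 0) (c, 2)) (h' : D.Conn S' (c, 0) (c, 2)) :
    Nat.card (D.Circle S) = Nat.card (D.Circle S') + 1 :=
  card_of_merge (circleAt_surjective hl S) (circleAt_surjective hl S') h
    fun _ _ => conn_iff_of_joined hS h'

theorem card_circle_insert_of_not_conn (hl : D.loops = 0) (halt : D.IsAlternating) (hc : c ∉ S)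
    (h : ¬ D.Conn S (c, 0) (c, 2)) :
    Nat.card (D.Circle S) = Nat.card (D.Circle (insert c S)) + 1 :=
  card_circle_of_joined hl (toggle_insert c S) h ((halt.conn_insert_iff hc).2 h)

theorem card_circle_insert_of_conn (hl : D.loops = 0) (halt : D.IsAlternating) (hc : c ∉ S)
    (h : D.Conn S (c, 0) (c, 2)) :
    Nat.card (D.Circle (insert c S)) = Nat.card (D.Circle S) + 1 :=
  card_circle_of_joined hl (toggle_insert' c S)
    (fun h' => (halt.conn_insert_iff hc).1 h' h) h

end LinkDiagram

namespace LinkDiagram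

variable {D : LinkDiagram} {S S' : D.State} {c : Fin D.n}

section Faces

instance (d : D.Dart) : Decidable (D.IsOver d) := by unfold IsOver; infer_instance

/-- The relation that generates the faces of the diagram. -/
abbrev FaceRel (D : LinkDiagram) (d d' : D.Dart) : Prop := d' = ((D.edge d).1, (D.edge d).2 + 1)

theorem faceRel_iff (d d' : D.Dart) : D.FaceRel d d' ↔
    d' = if D.IsOver (D.edge d) then D.smooth Finset.univ (D.edge d)
      else D.smooth ∅ (D.edge d) := by
  rcases h : D.edge d with ⟨c, k⟩
  rw [FaceRel, h]
  fin_cases k <;> simp [IsOver, smooth]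

/-- In an alternating diagram the boundaries of the faces are the circles of the two states in which
all smoothings are of the same kind. -/
theorem card_faces (hl : D.loops = 0) (halt : D.IsAlternating) :
    Nat.card (Quot D.FaceRel) = Nat.card (D.Circle ∅) + Nat.card (D.Circle Finset.univ) := by
  have : IsEmpty (Fin D.loops) := by rw [hl]; infer_instance
  have qe : ∀ S d, Quot.mk (fun d d' : D.Dart => d' = D.edge d ∨ d' = D.smooth S d) d
      = Quot.mk _ (D.edge d) := fun S d => Quot.sound (Or.inl rfl)
  have qs : ∀ S d, Quot.mk (fun d d' : D.Dart => d' = D.edge d ∨ d' = D.smooth S d) d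
      = Quot.mk _ (D.smooth S d) := fun S d => Quot.sound (Or.inr rfl)
  have h1 : ∀ S, Nat.card (D.Circle S)
      = Nat.card (Quot fun d d' : D.Dart => d' = D.edge d ∨ d' = D.smooth S d) := fun S =>
    Nat.card_congr (Equiv.sumEmpty _ _)
  rw [h1, h1, ← Nat.card_sum]
  have e1 : ∀ d, Quot.mk D.FaceRel d = Quot.mk D.FaceRel
      (if D.IsOver (D.edge d) then D.smooth Finset.univ (D.edge d)
      else D.smooth ∅ (D.edge d)) := fun d => Quot.sound ((faceRel_iff _ _).2 rfl)
  let F : Quot D.FaceRel →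
      Quot (fun d d' : D.Dart => d' = D.edge d ∨ d' = D.smooth ∅ d) ⊕
      Quot (fun d d' : D.Dart => d' = D.edge d ∨ d' = D.smooth Finset.univ d) :=
    Quot.lift (fun d => if D.IsOver d then Sum.inl (Quot.mk _ d) else Sum.inr (Quot.mk _ d)) (by
      intro d d' h
      rw [faceRel_iff] at h
      subst h
      by_cases hd : D.IsOver d
      · simp only [halt.isOver_edge, hd, not_true, if_false, if_true, isOver_smooth, not_false_iff]
        exact congrArg Sum.inl ((qe _ _).trans (qs _ _))
      · simp only [halt.isOver_edge, hd, not_true, if_false, if_true, isOver_smooth, not_false_iff]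
        exact congrArg Sum.inr ((qe _ _).trans (qs _ _)))
  let G0 : Quot (fun d d' : D.Dart => d' = D.edge d ∨ d' = D.smooth ∅ d) → Quot D.FaceRel :=
    Quot.lift (fun d => if D.IsOver d then Quot.mk _ d else Quot.mk _ (D.edge d)) (by
      rintro d d' (rfl | rfl)
      · by_cases hd : D.IsOver d <;> simp [halt.isOver_edge, hd, D.edge_edge]
      · by_cases hd : D.IsOver d
        · have := e1 (D.edge (D.smooth ∅ d))
          simp only [D.edge_edge, isOver_smooth, hd, not_true, if_false, smooth_smooth] at this
          simp only [isOver_smooth, hd, not_true, if_false, if_true, this]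
        · have := e1 (D.edge d)
          simp only [D.edge_edge, hd, if_false] at this
          simp only [isOver_smooth, hd, not_false_iff, if_false, if_true, this])
  let G1 : Quot (fun d d' : D.Dart => d' = D.edge d ∨ d' = D.smooth Finset.univ d) →
      Quot D.FaceRel :=
    Quot.lift (fun d => if D.IsOver d then Quot.mk _ (D.edge d) else Quot.mk _ d) (by
      rintro d d' (rfl | rfl)
      · by_cases hd : D.IsOver d <;> simp [halt.isOver_edge, hd, D.edge_edge]
      · by_cases hd : D.IsOver d
        · have := e1 (D.edge d)
          simp only [D.edge_edge, hd, if_true] at this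
          simp only [isOver_smooth, hd, not_true, if_false, if_true, this]
        · have := e1 (D.edge (D.smooth Finset.univ d))
          simp only [D.edge_edge, isOver_smooth, hd, not_false_iff, if_true, smooth_smooth] at this
          simp only [isOver_smooth, hd, not_false_iff, if_false, if_true, this])
  refine Nat.card_congr ⟨F, Sum.elim G0 G1, ?_, ?_⟩
  · rintro ⟨d⟩
    by_cases hd : D.IsOver d <;> simp [F, G0, G1, hd]
  · rintro (z | z) <;> obtain ⟨d, rfl⟩ := Quot.exists_rep z
    · by_cases hd : D.IsOver d
      · simp [F, G0, hd]
      · simp only [Sum.elim_inl, F, G0, hd, if_false, halt.isOver_edge, not_false_iff, if_true]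
        exact congrArg Sum.inl (qe _ _).symm
    · by_cases hd : D.IsOver d
      · simp only [Sum.elim_inr, F, G1, hd, if_false, halt.isOver_edge, not_true, if_true]
        exact congrArg Sum.inr (qe _ _).symm
      · simp [F, G1, hd]

end Faces

section Graph

/-- The components of the graph whose vertices are the circles of the state without
`1`-smoothings, and whose edges are the crossings in `S`. -/
def GraphComponent (D : LinkDiagram) (S : D.State) : Type :=
  Quot fun d d' : D.Dart => D.Conn ∅ d d' ∨ ∃ c ∈ S, d = (c, 0) ∧ d' = (c, 2)

instance (D : LinkDiagram) (S : D.State) : Finite (D.GraphComponent S) := by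
  unfold GraphComponent; infer_instance

def graphComponentAt (D : LinkDiagram) (S : D.State) (d : D.Dart) : D.GraphComponent S :=
  Quot.mk _ d

theorem graphComponentAt_surjective (S : D.State) :
    Function.Surjective (D.graphComponentAt S) := Quot.exists_rep

/-- The half-edges lie in the same component of the graph. -/
def GraphConn (D : LinkDiagram) (S : D.State) (d d' : D.Dart) : Prop :=
  D.graphComponentAt S d = D.graphComponentAt S d'

theorem GraphConn.rec_on {r : D.Dart → D.Dart → Prop} (hr : Equivalence r)
    (he : ∀ d d', D.Conn ∅ d d' → r d d') (hs : ∀ c ∈ S, r (c, 0) (c, 2)) {d d' : D.Dart}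
    (h : D.GraphConn S d d') : r d d' := by
  have h1 := Quot.eqvGen_exact h
  clear h
  induction h1 with
  | rel x y h =>
    rcases h with h | ⟨c, hc, rfl, rfl⟩
    · exact he x y h
    · exact hs c hc
  | refl x => exact hr.refl x
  | symm x y _ ih => exact hr.symm ih
  | trans x y z _ _ ih1 ih2 => exact hr.trans ih1 ih2

theorem graphConn_equivalence (S : D.State) : Equivalence (D.GraphConn S) :=
  ⟨fun _ => rfl, fun h => Eq.symm h, fun h g => Eq.trans h g⟩

theorem graphConn_of_conn_empty {d d' : D.Dart} (h : D.Conn ∅ d d') : D.GraphConn S d d' :=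
  Quot.sound (Or.inl h)

theorem graphConn_zero_two (hc : c ∈ S) : D.GraphConn S (c, 0) (c, 2) :=
  Quot.sound (Or.inr ⟨c, hc, rfl, rfl⟩)

theorem graphConn_empty_iff {d d' : D.Dart} : D.GraphConn ∅ d d' ↔ D.Conn ∅ d d' :=
  ⟨fun h => GraphConn.rec_on (r := D.Conn ∅) ⟨Conn.refl, Conn.symm, Conn.trans⟩
    (fun _ _ h => h) (by simp) h, graphConn_of_conn_empty⟩

theorem graphConn_zero_or_two (c : Fin D.n) (k : Fin 4) :
    D.GraphConn S (c, k) (c, 0) ∨ D.GraphConn S (c, k) (c, 2) :=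
  (conn_zero_or_two ∅ c k).imp graphConn_of_conn_empty graphConn_of_conn_empty

theorem graphConn_at (hc : c ∈ S) (k : Fin 4) : D.GraphConn S (c, k) (c, 0) :=
  (graphConn_zero_or_two c k).elim id fun h =>
    (graphConn_equivalence S).trans h ((graphConn_equivalence S).symm (graphConn_zero_two hc))

theorem Conn.graphConn {d d' : D.Dart} (h : D.Conn S d d') : D.GraphConn S d d' := by
  have hr := graphConn_equivalence S
  refine Conn.rec_on hr (fun d => graphConn_of_conn_empty (conn_edge d)) (fun d => ?_) h
  obtain ⟨c, k⟩ := d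
  by_cases hc : c ∈ S
  · exact hr.trans (graphConn_at hc k) (hr.symm (graphConn_at hc _))
  · rw [smooth_congr (S' := ∅) (by simpa using hc)]
    exact graphConn_of_conn_empty (conn_smooth _)

theorem GraphConn.mono (hS : S ⊆ S') {d d' : D.Dart} (h : D.GraphConn S d d') :
    D.GraphConn S' d d' :=
  GraphConn.rec_on (graphConn_equivalence S') (fun _ _ => graphConn_of_conn_empty)
    (fun _ hc => graphConn_zero_two (hS hc)) h

theorem graphConn_insert_iff {d d' : D.Dart} : D.GraphConn (insert c S) d d' ↔
    D.GraphConn S d d' ∨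
      ((D.GraphConn S d (c, 0) ∨ D.GraphConn S d (c, 2)) ∧
        (D.GraphConn S d' (c, 0) ∨ D.GraphConn S d' (c, 2))) := by
  have hr := graphConn_equivalence S
  have hr' := graphConn_equivalence (insert c S)
  have hsub : S ⊆ insert c S := Finset.subset_insert c S
  have h02 : D.GraphConn (insert c S) (c, 0) (c, 2) := graphConn_zero_two (by simp)
  constructor
  · refine GraphConn.rec_on (r := fun d d' => D.GraphConn S d d' ∨
      ((D.GraphConn S d (c, 0) ∨ D.GraphConn S d (c, 2)) ∧
        (D.GraphConn S d' (c, 0) ∨ D.GraphConn S d' (c, 2))))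
      ⟨fun d => Or.inl (hr.refl d), ?_, ?_⟩ ?_ ?_
    · rintro d d' (h | ⟨h, h'⟩)
      exacts [Or.inl (hr.symm h), Or.inr ⟨h', h⟩]
    · rintro d d' d'' (h | ⟨h, h'⟩) (g | ⟨g, g'⟩)
      · exact Or.inl (hr.trans h g)
      · exact Or.inr ⟨g.imp (hr.trans h) (hr.trans h), g'⟩
      · exact Or.inr ⟨h, h'.imp (hr.trans (hr.symm g)) (hr.trans (hr.symm g))⟩
      · exact Or.inr ⟨h, g'⟩
    · exact fun _ _ h => Or.inl (graphConn_of_conn_empty h)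
    · intro x hx
      rcases Finset.mem_insert.1 hx with rfl | hx
      · exact Or.inr ⟨Or.inl (hr.refl _), Or.inr (hr.refl _)⟩
      · exact Or.inl (graphConn_zero_two hx)
  · have key : ∀ d, (D.GraphConn S d (c, 0) ∨ D.GraphConn S d (c, 2)) →
        D.GraphConn (insert c S) d (c, 0) := fun d hd =>
      hd.elim (fun h => h.mono hsub) fun h => hr'.trans (h.mono hsub) (hr'.symm h02)
    rintro (h | ⟨h, h'⟩)
    · exact h.mono hsub
    · exact hr'.trans (key d h) (hr'.symm (key d' h'))

theorem card_graphComponent_insert_of_not_conn (h : ¬ D.GraphConn S (c, 0) (c, 2)) :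
    Nat.card (D.GraphComponent S) = Nat.card (D.GraphComponent (insert c S)) + 1 :=
  card_of_merge (graphComponentAt_surjective S) (graphComponentAt_surjective _) h
    fun _ _ => graphConn_insert_iff

theorem card_graphComponent_insert_of_conn (h : D.GraphConn S (c, 0) (c, 2)) :
    Nat.card (D.GraphComponent (insert c S)) = Nat.card (D.GraphComponent S) := by
  have hr := graphConn_equivalence S
  refine card_eq_of_fibers (graphComponentAt_surjective _) (graphComponentAt_surjective _)
    fun x y => ⟨fun h' => GraphConn.mono (Finset.subset_insert c S) h', fun h' => ?_⟩
  have key : ∀ d, (D.GraphConn S d (c, 0) ∨ D.GraphConn S d (c, 2)) → D.GraphConn S d (c, 0) :=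
    fun d hd => hd.elim id fun h' => hr.trans h' (hr.symm h)
  exact (graphConn_insert_iff.1 h').elim id fun h' =>
    hr.trans (key x h'.1) (hr.symm (key y h'.2))

/-- Twice the genus of the ribbon graph with edges `S`. -/
noncomputable def twiceGenus (D : LinkDiagram) (S : D.State) : ℤ :=
  S.card + 2 * Nat.card (D.GraphComponent S) - Nat.card (D.Circle S) - Nat.card (D.Circle ∅)

theorem twiceGenus_empty (hl : D.loops = 0) : D.twiceGenus ∅ = 0 := by
  have : Nat.card (D.GraphComponent ∅) = Nat.card (D.Circle ∅) :=
    card_eq_of_fibers (graphComponentAt_surjective _) (circleAt_surjective hl _)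
      fun _ _ => graphConn_empty_iff.symm
  rw [twiceGenus, this]
  simp
  ring

theorem twiceGenus_le_insert (hl : D.loops = 0) (halt : D.IsAlternating) (hc : c ∉ S) :
    D.twiceGenus S ≤ D.twiceGenus (insert c S) ∧
      (D.GraphConn S (c, 0) (c, 2) → D.twiceGenus (insert c S) ≤ D.twiceGenus S →
        D.Conn S (c, 0) (c, 2)) := by
  unfold twiceGenus
  rw [Finset.card_insert_of_notMem hc]
  by_cases h : D.Conn S (c, 0) (c, 2)
  · have h1 := card_graphComponent_insert_of_conn h.graphConn
    have h2 := card_circle_insert_of_conn hl halt hc h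
    exact ⟨by push_cast; omega, fun _ _ => h⟩
  · have h2 := card_circle_insert_of_not_conn hl halt hc h
    by_cases hg : D.GraphConn S (c, 0) (c, 2)
    · have h1 := card_graphComponent_insert_of_conn hg
      exact ⟨by push_cast; omega, fun _ h' => by push_cast at h'; omega⟩
    · have h1 := card_graphComponent_insert_of_not_conn hg
      exact ⟨by push_cast; omega, fun h' => absurd h' hg⟩

theorem twiceGenus_mono (hl : D.loops = 0) (halt : D.IsAlternating) (hS : S ⊆ S') :
    D.twiceGenus S ≤ D.twiceGenus S' := by
  obtain ⟨R, rfl⟩ : ∃ R, S' = S ∪ R := ⟨S', (Finset.union_eq_right.2 hS).symm⟩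
  clear hS
  induction R using Finset.induction_on with
  | empty => simp
  | insert c R _ ih =>
    rw [Finset.union_insert]
    by_cases hc : c ∈ S ∪ R
    · rwa [Finset.insert_eq_of_mem hc]
    · exact ih.trans (twiceGenus_le_insert hl halt hc).1

theorem card_graphComponent_univ : Nat.card (D.GraphComponent Finset.univ) =
    Nat.card (Quot fun d d' : D.Dart => d' = D.edge d ∨ d'.1 = d.1) := by
  refine card_eq_of_fibers (graphComponentAt_surjective _) Quot.exists_rep fun x y => ⟨?_, ?_⟩
  · intro h
    have h1 := Quot.eqvGen_exact h
    have hr := graphConn_equivalence (D := D) Finset.univ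
    clear h
    induction h1 with
    | rel x y h =>
      rcases h with rfl | h
      · exact graphConn_of_conn_empty (conn_edge x)
      · obtain ⟨c, k⟩ := x
        obtain ⟨c', k'⟩ := y
        obtain rfl : c' = c := h
        exact hr.trans (graphConn_at (by simp) k) (hr.symm (graphConn_at (by simp) k'))
    | refl x => exact hr.refl x
    | symm x y _ ih => exact hr.symm ih
    | trans x y z _ _ ih1 ih2 => exact hr.trans ih1 ih2
  · have hr : Equivalence fun x y : D.Dart => Quot.mk (fun d d' => d' = D.edge d ∨ d'.1 = d.1) x
        = Quot.mk (fun d d' => d' = D.edge d ∨ d'.1 = d.1) y :=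
      ⟨fun _ => rfl, fun h => Eq.symm h, fun h g => Eq.trans h g⟩
    refine GraphConn.rec_on hr ?_ ?_
    · intro d d' h
      refine Conn.rec_on hr ?_ ?_ h
      · exact fun d => Quot.sound (Or.inl rfl)
      · exact fun d => Quot.sound (Or.inr rfl)
    · exact fun c _ => Quot.sound (Or.inr rfl)

/-- The genus vanishes, by the planarity of the diagram. -/
theorem twiceGenus_eq_zero (hl : D.loops = 0) (halt : D.IsAlternating) (S : D.State) :
    D.twiceGenus S = 0 := by
  refine le_antisymm ((twiceGenus_mono hl halt (Finset.subset_univ S)).trans ?_)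
    ((twiceGenus_empty hl).symm.le.trans (twiceGenus_mono hl halt (Finset.empty_subset S)))
  have h1 := D.planar
  have h2 := card_faces hl halt
  rw [← card_graphComponent_univ] at h1
  unfold FaceRel at h2
  rw [h2] at h1
  rw [twiceGenus, Finset.card_univ, Fintype.card_fin]
  omega

theorem graphConn_iff_conn (hl : D.loops = 0) (halt : D.IsAlternating) (hc : c ∉ S) :
    D.GraphConn S (c, 0) (c, 2) ↔ D.Conn S (c, 0) (c, 2) :=
  ⟨fun h => (twiceGenus_le_insert hl halt hc).2 h
    (by rw [twiceGenus_eq_zero hl halt, twiceGenus_eq_zero hl halt]), Conn.graphConn⟩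

/-- A crossing at which a circle is cut also cuts a circle of every state with more
`1`-smoothings. -/
theorem Conn.mono (hl : D.loops = 0) (halt : D.IsAlternating) (hS : S ⊆ S') (hc : c ∉ S')
    (h : D.Conn S (c, 0) (c, 2)) : D.Conn S' (c, 0) (c, 2) :=
  (graphConn_iff_conn hl halt hc).1 (h.graphConn.mono hS)

theorem card_add_card_circle (hl : D.loops = 0) (halt : D.IsAlternating) (S : D.State) :
    (Nat.card (D.Circle S) : ℤ) + Nat.card (D.Circle ∅)
      = S.card + 2 * Nat.card (D.GraphComponent S) := by
  have := twiceGenus_eq_zero hl halt S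
  unfold twiceGenus at this
  omega

end Graph

section Knot

theorem IsKnot.card_eq (hknot : D.IsKnot) :
    Nat.card (Quot fun d d' : D.Dart => d' = D.edge d ∨ d' = D.opp d) + D.loops = 1 := by
  have h := hknot
  unfold IsKnot Component at h
  rwa [Nat.card_sum, Nat.card_eq_fintype_card (α := Fin D.loops), Fintype.card_fin] at h

theorem IsKnot.loops_eq_zero (hknot : D.IsKnot) (c : Fin D.n) : D.loops = 0 := by
  have h := hknot.card_eq
  have : Nonempty (Quot fun d d' : D.Dart => d' = D.edge d ∨ d' = D.opp d) := ⟨Quot.mk _ (c, 0)⟩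
  have := Nat.card_pos (α := Quot fun d d' : D.Dart => d' = D.edge d ∨ d' = D.opp d)
  omega

theorem IsKnot.graphConn_univ (hknot : D.IsKnot) (d d' : D.Dart) :
    D.GraphConn Finset.univ d d' := by
  have h := hknot.card_eq
  rw [hknot.loops_eq_zero d.1, add_zero] at h
  have hr := graphConn_equivalence (D := D) Finset.univ
  have := (Nat.card_eq_one_iff_unique.1 h).1
  have h1 := Quot.eqvGen_exact (this.elim (Quot.mk _ d) (Quot.mk _ d'))
  clear h this
  induction h1 with
  | rel x y h =>
    rcases h with rfl | rfl
    · exact graphConn_of_conn_empty (conn_edge x)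
    · obtain ⟨c, k⟩ := x
      exact hr.trans (graphConn_at (by simp) k) (hr.symm (graphConn_at (by simp) _))
  | refl x => exact hr.refl x
  | symm x y _ ih => exact hr.symm ih
  | trans x y z _ _ ih1 ih2 => exact hr.trans ih1 ih2

theorem card_circle_pos (c : Fin D.n) (S : D.State) : 0 < Nat.card (D.Circle S) :=
  have : Nonempty (D.Circle S) := ⟨D.circleAt S (c, 0)⟩
  Nat.card_pos

theorem card_of_card_circle_eq_one (hl : D.loops = 0) (halt : D.IsAlternating) (c : Fin D.n)
    (h : Nat.card (D.Circle S) = 1) : S.card + 1 = Nat.card (D.Circle ∅) := by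
  have h1 := card_add_card_circle hl halt S
  have h2 : Nat.card (D.GraphComponent S) = 1 := by
    rw [Nat.card_eq_one_iff_unique]
    refine ⟨⟨fun z w => ?_⟩, ⟨D.graphComponentAt S (c, 0)⟩⟩
    obtain ⟨x, rfl⟩ := graphComponentAt_surjective S z
    obtain ⟨y, rfl⟩ := graphComponentAt_surjective S w
    exact Conn.graphConn ((Nat.card_eq_one_iff_unique.1 h).1.elim _ _)
  omega

/-- There is a Kauffman state that consists of one circle. -/
theorem IsKnot.exists_card_circle_eq_one (hknot : D.IsKnot) (halt : D.IsAlternating)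
    (c : Fin D.n) : ∃ S : D.State, Nat.card (D.Circle S) = 1 := by
  classical
  have hl := hknot.loops_eq_zero c
  obtain ⟨S, hS, hmax⟩ := Finset.exists_max_image
    (Finset.univ.filter fun S : D.State => Nat.card (D.Circle S) + S.card = Nat.card (D.Circle ∅))
    Finset.card ⟨∅, by simp⟩
  simp only [Finset.mem_filter, Finset.mem_univ, true_and] at hS hmax
  have hr := graphConn_equivalence S
  have hconn : ∀ x, D.GraphConn S (x, 0) (x, 2) := by
    intro x
    by_cases hx : x ∈ S
    · exact graphConn_zero_two hx
    · by_contra h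
      rw [graphConn_iff_conn hl halt hx] at h
      have h1 := card_circle_insert_of_not_conn hl halt hx h
      have h2 := hmax (insert x S) (by rw [Finset.card_insert_of_notMem hx]; omega)
      rw [Finset.card_insert_of_notMem hx] at h2
      omega
  have hall : ∀ d d', D.GraphConn S d d' := fun d d' =>
    GraphConn.rec_on hr (fun _ _ => graphConn_of_conn_empty) (fun x _ => hconn x)
      (hknot.graphConn_univ d d')
  have h2 : Nat.card (D.GraphComponent S) = 1 := by
    rw [Nat.card_eq_one_iff_unique]
    refine ⟨⟨fun z w => ?_⟩, ⟨D.graphComponentAt S (c, 0)⟩⟩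
    obtain ⟨x, rfl⟩ := graphComponentAt_surjective S z
    obtain ⟨y, rfl⟩ := graphComponentAt_surjective S w
    exact hall x y
  have h3 := card_add_card_circle hl halt S
  exact ⟨S, by omega⟩

end Knot

end LinkDiagram

namespace LinkDiagram

open BasedComplex

variable {D : LinkDiagram} {S S' : D.State} {c : Fin D.n}

noncomputable instance (D : LinkDiagram) : Fintype D.Gen := Fintype.ofFinite _

section Labels

theorem lab_le_one (s : D.Gen) (d : D.Dart) : D.lab s d ≤ 1 := Nat.le_of_lt_succ (Fin.is_lt _)

theorem lab_eq_of_conn (s : D.Gen) {d d' : D.Dart} (h : D.Conn s.1 d d') :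
    D.lab s d = D.lab s d' := by
  unfold lab
  rw [show D.circleAt s.1 d = D.circleAt s.1 d' from h]

theorem gen_ext (hl : D.loops = 0) {s t : D.Gen} (h1 : s.1 = t.1)
    (h2 : ∀ d, D.lab s d = D.lab t d) : s = t := by
  obtain ⟨S, a⟩ := s
  obtain ⟨T, b⟩ := t
  simp only at h1
  subst h1
  congr 1
  funext z
  obtain ⟨d, rfl⟩ := circleAt_surjective hl S z
  exact Fin.ext (h2 d)

theorem exists_gen (hl : D.loops = 0) (S : D.State) {l : D.Dart → ℕ} (h1 : ∀ d, l d ≤ 1)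
    (h2 : ∀ d d', D.Conn S d d' → l d = l d') : ∃ s : D.Gen, s.1 = S ∧ ∀ d, D.lab s d = l d := by
  have hs := circleAt_surjective hl S
  refine ⟨⟨S, fun z => ⟨l (Function.surjInv hs z), Nat.lt_succ_of_le (h1 _)⟩⟩, rfl, fun d => ?_⟩
  exact h2 _ _ (Function.surjInv_eq hs _)

end Labels

section Joining

/-- The states agree away from the crossing, and the circles of `S'` arise from those of `S` by
joining the two circles that meet there. -/
structure Joins (D : LinkDiagram) (c : Fin D.n) (S S' : D.State) : Prop where
  agree : ∀ x ≠ c, x ∈ S ↔ x ∈ S'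
  not_conn : ¬ D.Conn S (c, 0) (c, 2)
  conn : D.Conn S' (c, 0) (c, 2)

theorem Joins.conn_iff_of_not_near (H : D.Joins c S S') {d : D.Dart} (hd : ¬ D.Near S c d)
    (d' : D.Dart) : D.Conn S' d d' ↔ D.Conn S d d' := by
  rw [conn_iff_of_joined H.agree H.conn]
  tauto

theorem Joins.conn_iff_of_near (H : D.Joins c S S') {d : D.Dart} (hd : D.Near S c d)
    (d' : D.Dart) : D.Conn S' d d' ↔ D.Near S c d' := by
  rw [conn_iff_of_joined H.agree H.conn]
  exact ⟨fun h => h.elim (fun h => hd.of_conn h.symm) fun h => h.2, fun h => Or.inr ⟨hd, h⟩⟩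

theorem Joins.near_iff (H : D.Joins c S S') {d : D.Dart} : D.Near S' c d ↔ D.Near S c d :=
  (near_toggle_iff H.agree).symm

theorem IsAlternating.joins_insert (halt : D.IsAlternating) (hc : c ∉ S)
    (h : ¬ D.Conn S (c, 0) (c, 2)) : D.Joins c S (insert c S) :=
  ⟨toggle_insert c S, h, (halt.conn_insert_iff hc).2 h⟩

theorem IsAlternating.joins_insert' (halt : D.IsAlternating) (hc : c ∉ S)
    (h : D.Conn S (c, 0) (c, 2)) : D.Joins c (insert c S) S :=
  ⟨toggle_insert' c S, fun h' => (halt.conn_insert_iff hc).1 h' h, h⟩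

theorem agreeAway_iff (hl : D.loops = 0) (s t : D.Gen) : D.AgreeAway c s t ↔
    ∀ d, ¬ D.Near s.1 c d → D.lab s d = D.lab t d := by
  have : IsEmpty (Fin D.loops) := by rw [hl]; infer_instance
  unfold AgreeAway
  simp only [IsEmpty.forall_iff, and_true, LinkDiagram.near_iff, not_exists]
  rfl

open scoped Classical in
theorem edgeCoeff_of_not_conn (hl : D.loops = 0) {s : D.Gen} (h : ¬ D.Conn s.1 (c, 0) (c, 2))
    (t : D.Gen) : D.edgeCoeff c s t =
      if (∀ d, ¬ D.Near s.1 c d → D.lab s d = D.lab t d) ∧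
        D.lab s (c, 0) + D.lab s (c, 2) = D.lab t (c, 0) then 1 else 0 := by
  unfold edgeCoeff
  rw [if_pos (show D.circleAt s.1 (c, 0) ≠ D.circleAt s.1 (c, 2) from h), agreeAway_iff hl, ite_and]
  split_ifs <;> rfl

open scoped Classical in
theorem edgeCoeff_of_conn (hl : D.loops = 0) {s : D.Gen} (h : D.Conn s.1 (c, 0) (c, 2))
    (t : D.Gen) : D.edgeCoeff c s t =
      if (∀ d, ¬ D.Near s.1 c d → D.lab s d = D.lab t d) ∧
        D.lab t (c, 0) + D.lab t (c, 2) = D.lab s (c, 0) + 1 then 1 else 0 := by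
  unfold edgeCoeff
  rw [if_neg (show ¬ D.circleAt s.1 (c, 0) ≠ D.circleAt s.1 (c, 2) from not_not.2 h),
    agreeAway_iff hl, ite_and]
  split_ifs <;> rfl

end Joining

section Monomials

open scoped Classical in
/-- The exponent at the circle through `d` of the monomial that is the product of the
`X_d' ^ m d'`. -/
noncomputable def tot (D : LinkDiagram) (S : D.State) (m : D.Dart → ℕ) (d : D.Dart) : ℕ :=
  ∑ d', if D.Conn S d d' then m d' else 0

open scoped Classical in
/-- The image in the tensor power of `𝒜` belonging to `S` of the monomial with exponents `m`, where
the variable of a half-edge is sent to the element `X` of the circle through it. -/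
noncomputable def vec (D : LinkDiagram) (S : D.State) (m : D.Dart → ℕ) (t : D.Gen) : ℤ :=
  if t.1 = S ∧ ∀ d, D.lab t d = D.tot S m d then 1 else 0

theorem tot_eq_of_conn {m : D.Dart → ℕ} {d d' : D.Dart} (h : D.Conn S d d') :
    D.tot S m d = D.tot S m d' := by
  classical
  unfold tot
  refine Finset.sum_congr rfl fun x _ => ?_
  have : D.Conn S d x ↔ D.Conn S d' x := ⟨h.symm.trans, h.trans⟩
  simp only [this]

open scoped Classical in
theorem tot_add_single (m : D.Dart → ℕ) (d x : D.Dart) :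
    D.tot S (m + Pi.single x 1) d = D.tot S m d + if D.Conn S d x then 1 else 0 := by
  classical
  unfold tot
  have : ∀ d' : D.Dart, (if D.Conn S d d' then (m + Pi.single x 1 : D.Dart → ℕ) d' else 0)
      = (if D.Conn S d d' then m d' else 0) + if d' = x then (if D.Conn S d x then 1 else 0) else 0 := by
    intro d'
    by_cases hx : d' = x
    · subst hx
      by_cases h : D.Conn S d d' <;> simp [h]
    · simp [hx]
  simp only [this, Finset.sum_add_distrib, Finset.sum_ite_eq', Finset.mem_univ, if_true]

theorem Joins.tot_of_not_near (H : D.Joins c S S') (m : D.Dart → ℕ) {d : D.Dart}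
    (hd : ¬ D.Near S c d) : D.tot S' m d = D.tot S m d := by
  classical
  unfold tot
  simp only [H.conn_iff_of_not_near hd]

theorem Joins.tot_of_near (H : D.Joins c S S') (m : D.Dart → ℕ) {d : D.Dart}
    (hd : D.Near S c d) : D.tot S' m d = D.tot S m (c, 0) + D.tot S m (c, 2) := by
  classical
  unfold tot
  rw [← Finset.sum_add_distrib]
  refine Finset.sum_congr rfl fun x _ => ?_
  simp only [H.conn_iff_of_near hd, Near]
  by_cases h0 : D.Conn S x (c, 0)
  · have h2 : ¬ D.Conn S (c, 2) x := fun h => H.not_conn (h0.symm.trans h.symm)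
    simp [h0, h0.symm, h2]
  · have h0' : ¬ D.Conn S (c, 0) x := fun h => h0 h.symm
    simp only [h0, h0', false_or, if_false, zero_add, conn_comm]

theorem Joins.tot_le (H : D.Joins c S S') (m : D.Dart → ℕ) (d : D.Dart) :
    D.tot S m d ≤ D.tot S' m d := by
  by_cases hd : D.Near S c d
  · rw [H.tot_of_near m hd]
    rcases hd with h | h <;> rw [tot_eq_of_conn h] <;> omega
  · rw [H.tot_of_not_near m hd]

theorem vec_congr (m : D.Dart → ℕ) {x y : D.Dart} (h : D.Conn S x y) :
    D.vec S (m + Pi.single x 1) = D.vec S (m + Pi.single y 1) := by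
  classical
  funext t
  unfold vec
  have : ∀ d, D.Conn S d x ↔ D.Conn S d y := fun d => ⟨fun h' => h'.trans h, fun h' => h'.trans h.symm⟩
  simp only [tot_add_single, this]

theorem exists_vec_eq_single (hl : D.loops = 0) [DecidableEq D.Gen] (s : D.Gen) :
    ∃ m, D.vec s.1 m = Pi.single s 1 := by
  classical
  have hs := circleAt_surjective hl s.1
  let r : D.Dart → D.Dart := fun d => Function.surjInv hs (D.circleAt s.1 d)
  have hr : ∀ d, D.Conn s.1 (r d) d := fun d => Function.surjInv_eq hs _
  have hr' : ∀ d d', D.Conn s.1 d d' → r d = r d' := fun d d' h =>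
    congrArg (Function.surjInv hs) h
  refine ⟨fun d => if r d = d then D.lab s d else 0, ?_⟩
  have ht : ∀ d, D.tot s.1 (fun d => if r d = d then D.lab s d else 0) d = D.lab s d := by
    intro d
    unfold tot
    rw [Finset.sum_eq_single (r d)]
    · beta_reduce
      rw [if_pos (hr d).symm, if_pos (hr' _ _ (hr d)), lab_eq_of_conn s (hr d)]
    · intro x _ hx
      by_cases h : D.Conn s.1 d x
      · beta_reduce
        rw [if_pos h, if_neg]
        intro h'
        exact hx (by rw [← h', hr' d x h])
      · rw [if_neg h]
    · simp
  funext t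
  unfold vec
  simp only [ht]
  by_cases h : t = s
  · subst h; simp
  · rw [Pi.single_eq_of_ne h, if_neg]
    rintro ⟨h1, h2⟩
    exact h (gen_ext hl h1 h2)

end Monomials

section Differential

open scoped Classical in
/-- The matrix of the unsigned maps belonging to the edges of the cube in the direction of a
crossing. -/
noncomputable def edgeMat (D : LinkDiagram) (c : Fin D.n) (s t : D.Gen) : ℤ :=
  if c ∉ s.1 ∧ t.1 = insert c s.1 then D.edgeCoeff c s t else 0

/-- The sign belonging to an edge of the cube. -/
def edgeSign (D : LinkDiagram) (c : Fin D.n) (S : D.State) : ℤ :=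
  (-1) ^ (S.filter (fun b => b < c)).card

theorem dCoeff_eq (s t : D.Gen) :
    D.dCoeff s t = ∑ c, D.edgeSign c s.1 * D.edgeMat c s t := by
  unfold dCoeff edgeMat edgeSign
  refine Finset.sum_congr rfl fun c _ => ?_
  by_cases h : c ∉ s.1 ∧ t.1 = insert c s.1 <;> simp [h]

open scoped Classical in
theorem bd_vec_aux (hl : D.loops = 0) (hc : c ∉ S) (m : D.Dart → ℕ) {t : D.Gen}
    (ht : t.1 = insert c S) :
    (∃ s : D.Gen, s.1 = S ∧ (∀ d, D.lab s d = D.tot S m d) ∧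
      bd (D.edgeMat c) (D.vec S m) t = D.edgeCoeff c s t) ∨
    (∃ d, 2 ≤ D.tot S m d) ∧ bd (D.edgeMat c) (D.vec S m) t = 0 := by
  by_cases h : ∀ d, D.tot S m d ≤ 1
  · obtain ⟨s, hs, hlab⟩ := exists_gen hl S h fun d d' hd => tot_eq_of_conn hd
    refine Or.inl ⟨s, hs, hlab, ?_⟩
    rw [bd, Finset.sum_eq_single s]
    · rw [vec, if_pos ⟨hs, hlab⟩, one_mul, edgeMat, if_pos ⟨by rwa [hs], by rw [ht, hs]⟩]
    · intro s' _ hs'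
      rw [vec, if_neg, zero_mul]
      rintro ⟨h1, h2⟩
      exact hs' (gen_ext hl (h1.trans hs.symm) fun d => by rw [h2, hlab])
    · simp
  · push Not at h
    obtain ⟨d, hd⟩ := h
    refine Or.inr ⟨⟨d, hd⟩, Finset.sum_eq_zero fun s _ => ?_⟩
    rw [vec, if_neg, zero_mul]
    rintro ⟨-, h2⟩
    have := lab_le_one s d
    rw [h2] at this
    omega

theorem bd_edgeMat_eq_zero (m : D.Dart → ℕ) {t : D.Gen} (ht : t.1 ≠ insert c S) :
    bd (D.edgeMat c) (D.vec S m) t = 0 := by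
  refine Finset.sum_eq_zero fun s _ => ?_
  unfold vec edgeMat
  by_cases h : s.1 = S
  · rw [h, if_neg (c := c ∉ S ∧ t.1 = insert c S) (fun h => ht h.2), mul_zero]
  · rw [if_neg (fun h' => h h'.1), zero_mul]

/-- Multiplication in `𝒜`, on monomials. -/
theorem bd_vec_of_not_conn (hl : D.loops = 0) (halt : D.IsAlternating) (hc : c ∉ S)
    (h : ¬ D.Conn S (c, 0) (c, 2)) (m : D.Dart → ℕ) :
    bd (D.edgeMat c) (D.vec S m) = D.vec (insert c S) m := by
  classical
  funext t
  by_cases ht : t.1 = insert c S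
  swap
  · rw [bd_edgeMat_eq_zero m ht, vec, if_neg fun h => ht h.1]
  have H := halt.joins_insert hc h
  rcases bd_vec_aux hl hc m ht with ⟨s, hs, hlab, e⟩ | ⟨⟨d, hd⟩, e⟩
  · rw [e, edgeCoeff_of_not_conn hl (by rwa [hs]), vec, hs]
    refine if_congr ⟨fun ⟨h1, h2⟩ => ⟨ht, fun d => ?_⟩, fun ⟨_, h1⟩ => ⟨fun d hd => ?_, ?_⟩⟩ rfl rfl
    · by_cases hd : D.Near S c d
      · rw [H.tot_of_near m hd, ← hlab, ← hlab, h2]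
        refine lab_eq_of_conn t ?_
        rw [ht, conn_comm, H.conn_iff_of_near (near_self 0)]
        exact hd
      · rw [H.tot_of_not_near m hd, ← hlab, h1 d hd]
    · rw [h1, H.tot_of_not_near m hd, hlab]
    · rw [h1, H.tot_of_near m (near_self 0), hlab, hlab]
  · rw [e, vec, if_neg]
    rintro ⟨-, h1⟩
    have h2 := H.tot_le m d
    have h3 := lab_le_one t d
    rw [h1] at h3
    omega

/-- Comultiplication in `𝒜`, on monomials. -/
theorem bd_vec_of_conn (hl : D.loops = 0) (halt : D.IsAlternating) (hc : c ∉ S)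
    (h : D.Conn S (c, 0) (c, 2)) (m : D.Dart → ℕ) :
    bd (D.edgeMat c) (D.vec S m) = D.vec (insert c S) (m + Pi.single (c, 0) 1)
      + D.vec (insert c S) (m + Pi.single (c, 2) 1) := by
  classical
  funext t
  rw [Pi.add_apply]
  by_cases ht : t.1 = insert c S
  swap
  · rw [bd_edgeMat_eq_zero m ht, vec, if_neg fun h => ht h.1, vec, if_neg fun h => ht h.1]
    rfl
  have H := halt.joins_insert' hc h
  set p := D.tot (insert c S) m (c, 0) with hp
  set q := D.tot (insert c S) m (c, 2) with hq
  have h02 := H.not_conn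
  have h20 : ¬ D.Conn (insert c S) (c, 2) (c, 0) := fun h => h02 h.symm
  have e0 : D.vec (insert c S) (m + Pi.single (c, 0) 1) t =
      if (∀ d, ¬ D.Near (insert c S) c d → D.lab t d = D.tot (insert c S) m d) ∧
        D.lab t (c, 0) = p + 1 ∧ D.lab t (c, 2) = q then 1 else 0 := by
    unfold vec
    simp only [tot_add_single]
    refine if_congr ⟨fun ⟨_, h1⟩ => ⟨fun d hd => ?_, ?_, ?_⟩,
      fun ⟨h1, h2, h3⟩ => ⟨ht, fun d => ?_⟩⟩ rfl rfl
    · rw [h1, if_neg fun h => hd (Or.inl h), add_zero]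
    · rw [h1, if_pos (Conn.refl _)]
    · rw [h1, if_neg h20, add_zero]
    · by_cases hd0 : D.Conn (insert c S) d (c, 0)
      · rw [if_pos hd0, tot_eq_of_conn hd0, ← hp, ← h2]
        exact lab_eq_of_conn t (by rwa [ht])
      · rw [if_neg hd0, add_zero]
        by_cases hd2 : D.Conn (insert c S) d (c, 2)
        · rw [tot_eq_of_conn hd2, ← hq, ← h3]
          exact lab_eq_of_conn t (by rwa [ht])
        · exact h1 d (by simp [Near, hd0, hd2])
  have e2 : D.vec (insert c S) (m + Pi.single (c, 2) 1) t =
      if (∀ d, ¬ D.Near (insert c S) c d → D.lab t d = D.tot (insert c S) m d) ∧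
        D.lab t (c, 0) = p ∧ D.lab t (c, 2) = q + 1 then 1 else 0 := by
    unfold vec
    simp only [tot_add_single]
    refine if_congr ⟨fun ⟨_, h1⟩ => ⟨fun d hd => ?_, ?_, ?_⟩,
      fun ⟨h1, h2, h3⟩ => ⟨ht, fun d => ?_⟩⟩ rfl rfl
    · rw [h1, if_neg fun h => hd (Or.inr h), add_zero]
    · rw [h1, if_neg h02, add_zero]
    · rw [h1, if_pos (Conn.refl _)]
    · by_cases hd2 : D.Conn (insert c S) d (c, 2)
      · rw [if_pos hd2, tot_eq_of_conn hd2, ← hq, ← h3]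
        exact lab_eq_of_conn t (by rwa [ht])
      · rw [if_neg hd2, add_zero]
        by_cases hd0 : D.Conn (insert c S) d (c, 0)
        · rw [tot_eq_of_conn hd0, ← hp, ← h2]
          exact lab_eq_of_conn t (by rwa [ht])
        · exact h1 d (by simp [Near, hd0, hd2])
  rw [e0, e2]
  have l0 := lab_le_one t (c, 0)
  have l2 := lab_le_one t (c, 2)
  rcases bd_vec_aux hl hc m ht with ⟨s, hs, hlab, e⟩ | ⟨⟨d, hd⟩, e⟩
  · have hle := lab_le_one s (c, 0)
    have hpq := hlab (c, 0)
    rw [H.tot_of_near m (near_self 0), ← hp, ← hq] at hpq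
    have hP : (∀ d, ¬ D.Near s.1 c d → D.lab s d = D.lab t d) ↔
        ∀ d, ¬ D.Near (insert c S) c d → D.lab t d = D.tot (insert c S) m d := by
      refine forall_congr' fun d => ?_
      rw [hs, H.near_iff]
      refine imp_congr_right fun hd => ?_
      rw [hlab, H.tot_of_not_near m hd, eq_comm]
    rw [e, edgeCoeff_of_conn hl (by rwa [hs])]
    simp only [hP]
    by_cases hA : ∀ d, ¬ D.Near (insert c S) c d → D.lab t d = D.tot (insert c S) m d
    · simp only [eq_true hA, true_and, hpq]
      split_ifs <;> omega
    · simp only [hA, false_and, if_false, add_zero]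
  · rw [e, if_neg, if_neg, add_zero]
    all_goals
      rintro ⟨h1, h2, h3⟩
      by_cases hn : D.Near (insert c S) c d
      · rw [H.tot_of_near m hn, ← hp, ← hq] at hd
        omega
      · have := lab_le_one t d
        rw [h1 d hn, ← H.tot_of_not_near m hn] at this
        omega

theorem bd_edgeMat_comm (hl : D.loops = 0) (halt : D.IsAlternating) {c c' : Fin D.n} (hne : c ≠ c')
    (hc : c ∉ S) (hc' : c' ∉ S) (m : D.Dart → ℕ) :
    bd (D.edgeMat c') (bd (D.edgeMat c) (D.vec S m))
      = bd (D.edgeMat c) (bd (D.edgeMat c') (D.vec S m)) := by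
  have hbd : ∀ (c : Fin D.n) x y, bd (D.edgeMat c) (x + y) = bd (D.edgeMat c) x + bd (D.edgeMat c) y :=
    fun c x y => funext fun t => bd_add x y t
  have h1 : c' ∉ insert c S := by simp [hc', hne.symm]
  have h2 : c ∉ insert c' S := by simp [hc, hne]
  have hU : insert c' (insert c S) = insert c (insert c' S) := Finset.insert_comm _ _ _
  have hm := fun h => Conn.mono hl halt (Finset.subset_insert c' S) h2 h
  have hm' := fun h => Conn.mono hl halt (Finset.subset_insert c S) h1 h
  have k1 := card_circle_insert_of_conn hl halt hc
  have k2 := card_circle_insert_of_not_conn hl halt hc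
  have k3 := card_circle_insert_of_conn hl halt hc'
  have k4 := card_circle_insert_of_not_conn hl halt hc'
  have k5 := card_circle_insert_of_conn hl halt h1
  have k6 := card_circle_insert_of_not_conn hl halt h1
  have k7 := card_circle_insert_of_conn hl halt h2
  have k8 := card_circle_insert_of_not_conn hl halt h2
  rw [hU] at k5 k6
  by_cases a : D.Conn S (c, 0) (c, 2)
  · have a' := hm a
    replace k1 := k1 a
    replace k7 := k7 a'
    rw [bd_vec_of_conn hl halt hc a, hbd]
    by_cases b : D.Conn S (c', 0) (c', 2)
    · have b' := hm' b
      simp only [bd_vec_of_conn hl halt hc' b, hbd, bd_vec_of_conn hl halt h1 b',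
        bd_vec_of_conn hl halt h2 a', hU]
      simp only [add_right_comm m]
      abel
    · have b' : ¬ D.Conn (insert c S) (c', 0) (c', 2) := fun b' => by
        replace k4 := k4 b
        replace k5 := k5 b'
        omega
      simp only [bd_vec_of_not_conn hl halt hc' b, bd_vec_of_not_conn hl halt h1 b',
        bd_vec_of_conn hl halt h2 a', hU]
  · replace k2 := k2 a
    rw [bd_vec_of_not_conn hl halt hc a]
    by_cases b : D.Conn S (c', 0) (c', 2)
    · have b' := hm' b
      have a' : ¬ D.Conn (insert c' S) (c, 0) (c, 2) := fun a' => by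
        replace k3 := k3 b
        replace k7 := k7 a'
        replace k5 := k5 b'
        omega
      simp only [bd_vec_of_conn hl halt hc' b, hbd, bd_vec_of_conn hl halt h1 b',
        bd_vec_of_not_conn hl halt h2 a', hU]
    · replace k4 := k4 b
      rw [bd_vec_of_not_conn hl halt hc' b]
      by_cases b' : D.Conn (insert c S) (c', 0) (c', 2)
      · replace k5 := k5 b'
        have a' : D.Conn (insert c' S) (c, 0) (c, 2) := by
          by_contra a'
          replace k8 := k8 a'
          omega
        rw [bd_vec_of_conn hl halt h1 b', bd_vec_of_conn hl halt h2 a', hU]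
        have hJ := halt.joins_insert' h1 b'
        rw [hU] at hJ
        have hn : ¬ D.Conn (insert c (insert c' S)) (c, 0) (c, 2) :=
          (halt.joins_insert' h2 a').not_conn
        have hj := ((conn_iff_of_joined hJ.agree hJ.conn).1 (halt.joins_insert hc a).conn).resolve_left
          hn
        rcases hj with ⟨g | g, g' | g'⟩
        · exact absurd (g.trans g'.symm) hn
        · rw [vec_congr m g, vec_congr m g']
        · rw [vec_congr m g, vec_congr m g', add_comm]
        · exact absurd (g.trans g'.symm) hn
      · replace k6 := k6 b'
        have a' : ¬ D.Conn (insert c' S) (c, 0) (c, 2) := fun a' => by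
          replace k7 := k7 a'
          omega
        rw [bd_vec_of_not_conn hl halt h1 b', bd_vec_of_not_conn hl halt h2 a', hU]

theorem sum_edgeMat_comm (hl : D.loops = 0) (halt : D.IsAlternating) {c c' : Fin D.n}
    (hne : c ≠ c') {s : D.Gen} (hc : c ∉ s.1) (hc' : c' ∉ s.1) (u : D.Gen) :
    ∑ t, D.edgeMat c s t * D.edgeMat c' t u = ∑ t, D.edgeMat c' s t * D.edgeMat c t u := by
  classical
  obtain ⟨m, hm⟩ := exists_vec_eq_single hl s
  have h := congrFun (bd_edgeMat_comm hl halt hne hc hc' m) u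
  have e : ∀ c t, bd (D.edgeMat c) (D.vec s.1 m) t = D.edgeMat c s t := fun c t => by
    rw [hm, bd, Finset.sum_eq_single s]
    · simp
    · intro s' _ hs'; rw [Pi.single_eq_of_ne hs', zero_mul]
    · simp
  simp only [bd] at h e
  simpa only [e] using h

theorem edgeSign_mul_edgeSign {c c' : Fin D.n} (hne : c ≠ c') (hc : c ∉ S) (hc' : c' ∉ S) :
    D.edgeSign c S * D.edgeSign c' (insert c S)
      = -(D.edgeSign c' S * D.edgeSign c (insert c' S)) := by
  unfold edgeSign
  rw [Finset.filter_insert, Finset.filter_insert]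
  rcases lt_or_gt_of_ne hne with h | h
  · rw [if_pos h, if_neg h.not_gt, Finset.card_insert_of_notMem (by simp [hc])]
    ring
  · rw [if_pos h, if_neg h.not_gt, Finset.card_insert_of_notMem (by simp [hc'])]
    ring

theorem edgeMat_ne_zero {s t : D.Gen} (h : D.edgeMat c s t ≠ 0) :
    c ∉ s.1 ∧ t.1 = insert c s.1 ∧ D.edgeCoeff c s t ≠ 0 := by
  unfold edgeMat at h
  split_ifs at h with h1
  · exact ⟨h1.1, h1.2, h⟩
  · exact absurd rfl h

theorem dCoeff_ne_zero {s t : D.Gen} (h : D.dCoeff s t ≠ 0) :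
    ∃ c ∉ s.1, t.1 = insert c s.1 ∧ D.edgeCoeff c s t ≠ 0 := by
  rw [dCoeff_eq] at h
  obtain ⟨c, -, hc⟩ := Finset.exists_ne_zero_of_sum_ne_zero h
  obtain ⟨h1, h2⟩ := edgeMat_ne_zero (right_ne_zero_of_mul hc)
  exact ⟨c, h1, h2⟩

/-- The differential squares to zero. -/
theorem sum_dCoeff_mul_dCoeff (hl : D.loops = 0) (halt : D.IsAlternating) (s u : D.Gen) :
    ∑ t, D.dCoeff s t * D.dCoeff t u = 0 := by
  let a : Fin D.n → Fin D.n → ℤ := fun c c' =>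
    D.edgeSign c s.1 * D.edgeSign c' (insert c s.1) * ∑ t, D.edgeMat c s t * D.edgeMat c' t u
  have h1 : ∑ t, D.dCoeff s t * D.dCoeff t u = ∑ c, ∑ c', a c c' := by
    simp only [dCoeff_eq, a, Finset.mul_sum]
    simp only [Finset.sum_mul_sum, ← Finset.mul_sum]
    simp only [Finset.mul_sum]
    rw [Finset.sum_comm]
    refine Finset.sum_congr rfl fun c _ => ?_
    rw [Finset.sum_comm]
    refine Finset.sum_congr rfl fun c' _ => Finset.sum_congr rfl fun t _ => ?_
    by_cases h : D.edgeMat c s t = 0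
    · simp [h]
    · rw [(edgeMat_ne_zero h).2.1]; ring
  have h0 : ∀ c c', c ∈ s.1 ∨ c' ∈ s.1 ∨ c = c' → a c c' = 0 := by
    intro c c' h
    refine mul_eq_zero_of_right _ (Finset.sum_eq_zero fun t _ => ?_)
    by_contra hne
    obtain ⟨g1, g2, -⟩ := edgeMat_ne_zero (left_ne_zero_of_mul hne)
    obtain ⟨g3, -, -⟩ := edgeMat_ne_zero (right_ne_zero_of_mul hne)
    rw [g2, Finset.mem_insert, not_or] at g3
    rcases h with h | h | h
    exacts [g1 h, g3.2 h, g3.1 h.symm]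
  have h2 : ∀ c c', a c c' = - a c' c := by
    intro c c'
    by_cases h : c ∈ s.1 ∨ c' ∈ s.1 ∨ c = c'
    · rw [h0 c c' h, h0 c' c (by tauto), neg_zero]
    · push Not at h
      obtain ⟨hc, hc', hne⟩ := h
      simp only [a]
      rw [edgeSign_mul_edgeSign hne hc hc', sum_edgeMat_comm hl halt hne hc hc', neg_mul]
  have h3 : ∑ c, ∑ c', a c c' = -∑ c, ∑ c', a c c' := by
    conv_lhs => rw [Finset.sum_comm]
    rw [← Finset.sum_neg_distrib]
    refine Finset.sum_congr rfl fun c _ => ?_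
    rw [← Finset.sum_neg_distrib]
    exact Finset.sum_congr rfl fun c' _ => h2 c' c
  rw [h1]
  omega

/-- The sums of the degrees of the tensor factors in two states, one of which arises from the other
by joining two circles. -/
theorem finsum_degree_of_joins (hl : D.loops = 0) {s t : D.Gen} (H : D.Joins c s.1 t.1)
    (h : ∀ d, ¬ D.Near s.1 c d → D.lab s d = D.lab t d) :
    ∑ᶠ z, (1 - 2 * ((s.2 z : ℕ) : ℤ)) + (1 - 2 * D.lab t (c, 0)) =
      ∑ᶠ z, (1 - 2 * ((t.2 z : ℕ) : ℤ)) + (1 - 2 * D.lab s (c, 0)) + (1 - 2 * D.lab s (c, 2)) := by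
  refine finsum_add_of_merge (circleAt_surjective hl s.1) (circleAt_surjective hl t.1) H.not_conn
    (fun _ _ => conn_iff_of_joined H.agree H.conn) (fun z => 1 - 2 * ((s.2 z : ℕ) : ℤ))
    (fun z => 1 - 2 * ((t.2 z : ℕ) : ℤ)) fun d h0 h2 => ?_
  have := h d (fun h => h.elim h0 h2)
  simp only [lab] at this
  simp only [this]

theorem qdeg_eq_of_edgeCoeff_ne_zero (hl : D.loops = 0) (halt : D.IsAlternating) {s t : D.Gen}
    (hc : c ∉ s.1) (ht : t.1 = insert c s.1) (h : D.edgeCoeff c s t ≠ 0) :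
    D.qdeg t = D.qdeg s := by
  unfold qdeg
  have hcard : t.1.card = s.1.card + 1 := by rw [ht, Finset.card_insert_of_notMem hc]
  by_cases h02 : D.Conn s.1 (c, 0) (c, 2)
  · rw [edgeCoeff_of_conn hl h02] at h
    simp only [ne_eq, ite_eq_right_iff, one_ne_zero, imp_false, not_not] at h
    have H := halt.joins_insert' hc h02
    rw [← ht] at H
    have := finsum_degree_of_joins hl H fun d hd => (h.1 d (by rwa [H.near_iff])).symm
    omega
  · rw [edgeCoeff_of_not_conn hl h02] at h
    simp only [ne_eq, ite_eq_right_iff, one_ne_zero, imp_false, not_not] at h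
    have H := halt.joins_insert hc h02
    rw [← ht] at H
    have := finsum_degree_of_joins hl H h.1
    omega

theorem isDiff (hl : D.loops = 0) (halt : D.IsAlternating) :
    IsDiff D.dCoeff D.hdeg D.qdeg where
  sq := sum_dCoeff_mul_dCoeff hl halt
  hdeg s t h := by
    obtain ⟨c, hc, ht, -⟩ := dCoeff_ne_zero h
    unfold hdeg
    rw [ht, Finset.card_insert_of_notMem hc]
    push_cast
    rfl
  qdeg s t h := by
    obtain ⟨c, hc, ht, h'⟩ := dCoeff_ne_zero h
    exact qdeg_eq_of_edgeCoeff_ne_zero hl halt hc ht h'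

end Differential

end LinkDiagram

namespace LinkDiagram

variable {D : LinkDiagram} {A B S S' : D.State} {c : Fin D.n}

section Intervals

/-- If all states with one circle in an interval contain a crossing, then the crossing joins two
circles of every state in the interval. -/
theorem not_conn_of_forall_mem (hl : D.loops = 0) (halt : D.IsAlternating) {T : D.State}
    (hAT : A ⊆ T) (hTB : T ⊆ B) (hT : Nat.card (D.Circle T) = 1)
    (hA : c ∉ A)
    (H : ∀ T, A ⊆ T → T ⊆ B → Nat.card (D.Circle T) = 1 → c ∈ T) (hSB : S ⊆ B) (hcS : c ∉ S) :
    ¬ D.Conn S (c, 0) (c, 2) := by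
  have hcT := H T hAT hTB hT
  obtain ⟨T₀, hcT₀, rfl⟩ : ∃ T₀, c ∉ T₀ ∧ insert c T₀ = T :=
    ⟨T.erase c, Finset.notMem_erase _ _, Finset.insert_erase hcT⟩
  have hAT₀ : A ⊆ T₀ := fun x hx => (Finset.mem_insert.1 (hAT hx)).resolve_left
    fun h => hA (h ▸ hx)
  have hT₀B : T₀ ⊆ B := (Finset.subset_insert _ _).trans hTB
  have h0 : ¬ D.Conn T₀ (c, 0) (c, 2) := fun h => by
    have h1 := card_circle_insert_of_conn hl halt hcT₀ h
    have h2 := card_circle_pos c T₀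
    omega
  have h2 := card_circle_insert_of_not_conn hl halt hcT₀ h0
  have key : ∀ R : D.State, R ⊆ B → c ∉ R → ¬ D.Conn (T₀ ∪ R) (c, 0) (c, 2) := by
    intro R
    induction R using Finset.induction_on with
    | empty => intro _ _; simpa using h0
    | insert x R hx ih =>
      intro hRB hcR
      rw [Finset.insert_subset_iff] at hRB
      rw [Finset.mem_insert, not_or] at hcR
      have ih := ih hRB.2 hcR.2
      rw [Finset.union_insert]
      by_cases hxS : x ∈ T₀ ∪ R
      · rwa [Finset.insert_eq_of_mem hxS]
      intro hconn
      have hcS : c ∉ T₀ ∪ R := by simp [hcT₀, hcR.2]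
      have hcSx : c ∉ insert x (T₀ ∪ R) := by simp [hcT₀, hcR.2, hcR.1]
      have hxSc : x ∉ insert c (T₀ ∪ R) := by
        rw [Finset.mem_insert, not_or]; exact ⟨fun h => hcR.1 h.symm, hxS⟩
      have e1 := card_circle_insert_of_not_conn hl halt hcS ih
      have e2 := card_circle_insert_of_conn hl halt hcSx hconn
      rw [Finset.insert_comm] at e2
      have hx0 : ¬ D.Conn (T₀ ∪ R) (x, 0) (x, 2) := fun h => by
        have e3 := card_circle_insert_of_conn hl halt hxS h
        by_cases h' : D.Conn (insert c (T₀ ∪ R)) (x, 0) (x, 2)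
        · have e4 := card_circle_insert_of_conn hl halt hxSc h'
          omega
        · have e4 := card_circle_insert_of_not_conn hl halt hxSc h'
          omega
      have hxT : ¬ D.Conn T₀ (x, 0) (x, 2) := fun h =>
        hx0 (h.mono hl halt Finset.subset_union_left hxS)
      have hxT₀ : x ∉ T₀ := fun h => hxS (Finset.mem_union_left _ h)
      have e5 := card_circle_insert_of_not_conn hl halt hxT₀ hxT
      have := H (insert x T₀) (hAT₀.trans (Finset.subset_insert _ _))
        (Finset.insert_subset hRB.1 hT₀B) (by omega)
      rw [Finset.mem_insert] at this
      exact this.elim hcR.1 hcT₀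
  intro h
  exact key S hSB hcS (h.mono hl halt Finset.subset_union_right (by simp [hcT₀, hcS]))

/-- If no state with one circle in an interval contains a crossing, then the crossing cuts a circle
of every state in the interval. -/
theorem conn_of_forall_notMem (hl : D.loops = 0) (halt : D.IsAlternating) {T : D.State}
    (hAT : A ⊆ T) (hTB : T ⊆ B) (hT : Nat.card (D.Circle T) = 1) (hcB : c ∈ B)
    (H : ∀ T, A ⊆ T → T ⊆ B → Nat.card (D.Circle T) = 1 → c ∉ T) (hAS : A ⊆ S) (hcS : c ∉ S) :
    D.Conn S (c, 0) (c, 2) := by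
  have hcT := H T hAT hTB hT
  suffices hA : D.Conn A (c, 0) (c, 2) from hA.mono hl halt hAS hcS
  by_contra hA
  have hTc : D.Conn T (c, 0) (c, 2) := by
    by_contra h
    have h1 := card_circle_insert_of_not_conn hl halt hcT h
    have h2 := card_circle_pos c (insert c T)
    omega
  have f1 := card_circle_insert_of_conn hl halt hcT hTc
  have key : ∀ R : D.State, R ⊆ T → ¬ D.Conn (A ∪ R) (c, 0) (c, 2) := by
    intro R
    induction R using Finset.induction_on with
    | empty => intro _; simpa using hA
    | insert x R hx ih =>
      intro hRT
      rw [Finset.insert_subset_iff] at hRT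
      have ih := ih hRT.2
      rw [Finset.union_insert]
      by_cases hxS : x ∈ A ∪ R
      · rwa [Finset.insert_eq_of_mem hxS]
      intro hconn
      have hST : A ∪ R ⊆ T := Finset.union_subset hAT hRT.2
      have hcS : c ∉ A ∪ R := fun h => hcT (hST h)
      have hxc : x ≠ c := fun h => hcT (h ▸ hRT.1)
      have hcSx : c ∉ insert x (A ∪ R) := by
        rw [Finset.mem_insert, not_or]; exact ⟨hxc.symm, hcS⟩
      have hxSc : x ∉ insert c (A ∪ R) := by
        rw [Finset.mem_insert, not_or]; exact ⟨hxc, hxS⟩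
      have e1 := card_circle_insert_of_not_conn hl halt hcS ih
      have e2 := card_circle_insert_of_conn hl halt hcSx hconn
      rw [Finset.insert_comm] at e2
      have hx1 : D.Conn (insert c (A ∪ R)) (x, 0) (x, 2) := by
        by_contra h
        have e3 := card_circle_insert_of_not_conn hl halt hxSc h
        by_cases h' : D.Conn (A ∪ R) (x, 0) (x, 2)
        · have e4 := card_circle_insert_of_conn hl halt hxS h'
          omega
        · have e4 := card_circle_insert_of_not_conn hl halt hxS h'
          omega
      have hsub : A ∪ R ⊆ T.erase x := fun y hy =>
        Finset.mem_erase.2 ⟨fun h => hxS (h ▸ hy), hST hy⟩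
      have hcE : c ∉ T.erase x := fun h => hcT (Finset.mem_of_mem_erase h)
      have hxE : x ∉ insert c (T.erase x) := by simp [hxc]
      have h3 := hx1.mono hl halt (Finset.insert_subset_insert c hsub) hxE
      have e5 := card_circle_insert_of_conn hl halt hxE h3
      rw [Finset.insert_comm, Finset.insert_erase hRT.1] at e5
      exact H (insert c (T.erase x))
        ((Finset.subset_union_left.trans hsub).trans (Finset.subset_insert _ _))
        (Finset.insert_subset hcB ((Finset.erase_subset _ _).trans hTB)) (by omega)
        (Finset.mem_insert_self _ _)
  have := key T subset_rfl
  rw [Finset.union_eq_right.2 hAT] at this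
  exact this hTc

end Intervals

section Leaves

/-- A circle of a state touches exactly one crossing in `B \ A`, on one side. -/
theorem exists_leaf (hl : D.loops = 0) (halt : D.IsAlternating) {T : D.State}
    (hAT : A ⊆ T) (hTB : T ⊆ B) (hT : Nat.card (D.Circle T) = 1) (hne : (B \ A).Nonempty)
    (H : ∀ c ∈ B \ A, (∀ S, A ⊆ S → S ⊆ B → c ∉ S → ¬ D.Conn S (c, 0) (c, 2)) ∨
      ∀ S, A ⊆ S → S ⊆ B → c ∉ S → D.Conn S (c, 0) (c, 2)) :
    ∃ c ∈ B \ A, ∃ p o : D.Dart, (p = (c, 0) ∧ o = (c, 2) ∨ p = (c, 2) ∧ o = (c, 0)) ∧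
      ∃ S, A ⊆ S ∧ S ⊆ B ∧
        (c ∉ S → ∀ S, A ⊆ S → S ⊆ B → c ∉ S → ¬ D.Conn S (c, 0) (c, 2)) ∧
        (c ∈ S → ∀ S, A ⊆ S → S ⊆ B → c ∉ S → D.Conn S (c, 0) (c, 2)) ∧
        ∀ d, D.Conn S p d → d.1 ∈ B \ A → d.1 = c := by
  classical
  let lp : Fin D.n → Prop := fun c => ∀ S, A ⊆ S → S ⊆ B → c ∉ S → D.Conn S (c, 0) (c, 2)
  set Lo := (B \ A).filter lp with hLo
  set Br := (B \ A).filter (fun c => ¬ lp c) with hBr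
  have hlo : ∀ c ∈ Lo, lp c := fun c hc => (Finset.mem_filter.1 hc).2
  have hbr : ∀ c ∈ Br, ∀ S, A ⊆ S → S ⊆ B → c ∉ S → ¬ D.Conn S (c, 0) (c, 2) := fun c hc =>
    (H c (Finset.mem_filter.1 hc).1).resolve_right (Finset.mem_filter.1 hc).2
  have hLoB : Lo ⊆ B := fun x hx => (Finset.mem_sdiff.1 (Finset.mem_filter.1 hx).1).1
  have hBrB : Br ⊆ B := fun x hx => (Finset.mem_sdiff.1 (Finset.mem_filter.1 hx).1).1
  have hLoA : ∀ x ∈ Lo, x ∉ A := fun x hx => (Finset.mem_sdiff.1 (Finset.mem_filter.1 hx).1).2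
  have hBrA : ∀ x ∈ Br, x ∉ A := fun x hx => (Finset.mem_sdiff.1 (Finset.mem_filter.1 hx).1).2
  have hAB := hAT.trans hTB
  have hTeq : T = A ∪ Br := by
    ext x
    rw [Finset.mem_union]
    constructor
    · intro hx
      by_contra h
      rw [not_or] at h
      have hxL : x ∈ Lo := by
        have hxs : x ∈ B \ A := Finset.mem_sdiff.2 ⟨hTB hx, h.1⟩
        rw [hLo, Finset.mem_filter]
        refine ⟨hxs, ?_⟩
        by_contra h'
        exact h.2 (Finset.mem_filter.2 ⟨hxs, h'⟩)
      have h1 := hlo x hxL (T.erase x) (fun y hy => Finset.mem_erase.2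
        ⟨fun e => h.1 (e ▸ hy), hAT hy⟩) ((Finset.erase_subset _ _).trans hTB)
        (Finset.notMem_erase _ _)
      have h2 := card_circle_insert_of_conn hl halt (Finset.notMem_erase _ _) h1
      rw [Finset.insert_erase hx] at h2
      have := card_circle_pos x (T.erase x)
      omega
    · rintro (hx | hx)
      · exact hAT hx
      · by_contra hxT
        have h2 := card_circle_insert_of_not_conn hl halt hxT (hbr x hx T hAT hTB hxT)
        have := card_circle_pos x (insert x T)
        omega
  have h1 : ∀ R ⊆ Br, Nat.card (D.Circle A) = Nat.card (D.Circle (A ∪ R)) + R.card := by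
    intro R
    induction R using Finset.induction_on with
    | empty => simp
    | insert x R hx ih =>
      intro hR
      rw [Finset.insert_subset_iff] at hR
      rw [Finset.union_insert, Finset.card_insert_of_notMem hx]
      have hxS : x ∉ A ∪ R := by simp [hx, hBrA x hR.1]
      have := card_circle_insert_of_not_conn hl halt hxS (hbr x hR.1 _ Finset.subset_union_left
        (Finset.union_subset hAB (hR.2.trans hBrB)) hxS)
      have := ih hR.2
      omega
  have h2 : ∀ R ⊆ Lo, Nat.card (D.Circle (A ∪ R)) = Nat.card (D.Circle A) + R.card := by
    intro R
    induction R using Finset.induction_on with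
    | empty => simp
    | insert x R hx ih =>
      intro hR
      rw [Finset.insert_subset_iff] at hR
      rw [Finset.union_insert, Finset.card_insert_of_notMem hx]
      have hxS : x ∉ A ∪ R := by simp [hx, hLoA x hR.1]
      have := card_circle_insert_of_conn hl halt hxS (hlo x hR.1 _ Finset.subset_union_left
        (Finset.union_subset hAB (hR.2.trans hLoB)) hxS)
      have := ih hR.2
      omega
  have h1 := h1 Br subset_rfl
  have h2 := h2 Lo subset_rfl
  rw [← hTeq, hT] at h1
  have h3 : Lo.card + Br.card = (B \ A).card := Finset.card_filter_add_card_filter_not _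
  set S := A ∪ Lo with hS
  have hAS : A ⊆ S := Finset.subset_union_left
  have hSB : S ⊆ B := Finset.union_subset hAB hLoB
  have : Fintype (D.Circle S) := Fintype.ofFinite _
  obtain ⟨z, -, hz⟩ := Finset.exists_card_fiber_lt_of_card_lt_mul
    (s := (B \ A) ×ˢ ({0, 2} : Finset (Fin 4))) (t := Finset.univ) (f := D.circleAt S) (n := 2)
    (by
      rw [Finset.card_product, Finset.card_univ, ← Nat.card_eq_fintype_card,
        show ({0, 2} : Finset (Fin 4)).card = 2 from rfl]
      omega)
  obtain ⟨d, rfl⟩ := circleAt_surjective hl S z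
  have hside : ∀ x ∈ B \ A, ∀ k, D.Conn S d (x, k) →
      ∃ k' : Fin 4, (k' = 0 ∨ k' = 2) ∧ D.Conn S (x, k') d := by
    intro x _ k h
    rcases conn_zero_or_two S x k with h' | h'
    · exact ⟨0, Or.inl rfl, (h.trans h').symm⟩
    · exact ⟨2, Or.inr rfl, (h.trans h').symm⟩
  have hex : ∃ x ∈ B \ A, ∃ k, D.Conn S d (x, k) := by
    by_contra hno
    push Not at hno
    obtain ⟨x, hx⟩ := hne
    refine hno x hx 0 ((conn_iff_of_agree (S' := T) (fun d' hd' => ?_) _).2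
      ((Nat.card_eq_one_iff_unique.1 hT).1.elim _ _))
    have h4 : d'.1 ∉ B \ A := fun h => hno d'.1 h d'.2 hd'
    rw [Finset.mem_sdiff, not_and_not_right] at h4
    exact ⟨fun h => hAT (h4 (hSB h)), fun h => hAS (h4 (hTB h))⟩
  obtain ⟨c, hc, k, hk⟩ := hex
  obtain ⟨k, hk02, hkd⟩ := hside c hc k hk
  have huniq : ∀ x ∈ B \ A, ∀ k' : Fin 4, (k' = 0 ∨ k' = 2) → D.Conn S (x, k') d →
      (x, k') = (c, k) := by
    intro x hx k' hk' hconn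
    refine Finset.card_le_one.1 (Nat.le_of_lt_succ hz) _ ?_ _ ?_
    · rw [Finset.mem_filter, Finset.mem_product]
      exact ⟨⟨hx, by simpa using hk'⟩, hconn⟩
    · rw [Finset.mem_filter, Finset.mem_product]
      exact ⟨⟨hc, by simpa using hk02⟩, hkd⟩
  refine ⟨c, hc, (c, k), (c, k + 2), ?_, S, hAS, hSB, fun hcS => ?_, fun hcS => ?_, ?_⟩
  · rcases hk02 with rfl | rfl
    exacts [Or.inl ⟨rfl, rfl⟩, Or.inr ⟨rfl, rfl⟩]
  · refine hbr c (Finset.mem_filter.2 ⟨hc, fun h => hcS ?_⟩)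
    exact Finset.mem_union_right _ (Finset.mem_filter.2 ⟨hc, h⟩)
  · rcases Finset.mem_union.1 hcS with h | h
    · exact absurd h (Finset.mem_sdiff.1 hc).2
    · exact hlo c h
  · rintro ⟨x, k'⟩ hconn hx
    obtain ⟨k'', h02, h'⟩ := hside x hx k' (hkd.symm.trans hconn)
    exact congrArg Prod.fst (huniq x hx k'' h02 h')

end Leaves

end LinkDiagram

namespace LinkDiagram

open BasedComplex

variable {D : LinkDiagram} {A B S S' : D.State} {c : Fin D.n}

/-- The smoothing at the crossing is changed. -/
def toggle (D : LinkDiagram) (c : Fin D.n) (S : D.State) : D.State :=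
  if c ∈ S then S.erase c else insert c S

theorem mem_toggle_self : c ∈ D.toggle c S ↔ c ∉ S := by
  unfold toggle
  split_ifs with h <;> simp [h]

theorem mem_toggle_of_ne {x : Fin D.n} (h : x ≠ c) : x ∈ D.toggle c S ↔ x ∈ S := by
  unfold toggle
  split_ifs <;> simp [h]

theorem toggle_toggle (c : Fin D.n) (S : D.State) : D.toggle c (D.toggle c S) = S := by
  ext x
  by_cases h : x = c
  · subst h; rw [mem_toggle_self, mem_toggle_self, not_not]
  · rw [mem_toggle_of_ne h, mem_toggle_of_ne h]

theorem toggle_of_notMem (h : c ∉ S) : D.toggle c S = insert c S := if_neg h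

theorem toggle_insert_self (h : c ∉ S) : D.toggle c (insert c S) = S := by
  rw [← toggle_of_notMem h, toggle_toggle]

/-- A circle that touches a crossing on one side, and no other crossing in `B \ A`: the set `W` of
half-edges is a circle of all states in the interval between `A` and `B` in which the crossing has
the smoothing selected by `b`, and is joined to the circle on the other side of the crossing by
the other smoothing. -/
structure IsLeaf (D : LinkDiagram) (A B : D.State) (c : Fin D.n) (p o : D.Dart) (b : Prop)
    (W : Set D.Dart) : Prop where
  sides : p = (c, 0) ∧ o = (c, 2) ∨ p = (c, 2) ∧ o = (c, 0)
  mem_iff : ∀ S, A ⊆ S → S ⊆ B → (c ∈ S ↔ b) → ∀ d, d ∈ W ↔ D.Conn S p d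
  joins : ∀ S, A ⊆ S → S ⊆ B → (c ∈ S ↔ b) → D.Joins c S (D.toggle c S)
  live : ∀ d ∈ W, d.1 ∈ B \ A → d.1 = c

namespace IsLeaf

variable {p o : D.Dart} {b : Prop} {W : Set D.Dart} (L : D.IsLeaf A B c p o b W)
include L

section State

variable (hA : A ⊆ S) (hB : S ⊆ B) (hb : c ∈ S ↔ b)
include hA hB hb

theorem mem_left : p ∈ W := (L.mem_iff S hA hB hb p).2 (Conn.refl p)

theorem notMem_right : o ∉ W := fun h => by
  have h1 := (L.mem_iff S hA hB hb o).1 h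
  have h2 := (L.joins S hA hB hb).not_conn
  rcases L.sides with ⟨rfl, rfl⟩ | ⟨rfl, rfl⟩
  exacts [h2 h1, h2 h1.symm]

theorem near_iff {d : D.Dart} : D.Near S c d ↔ d ∈ W ∨ D.Conn S d o := by
  rw [L.mem_iff S hA hB hb, Near, conn_comm (d := p)]
  rcases L.sides with ⟨rfl, rfl⟩ | ⟨rfl, rfl⟩
  · rfl
  · exact or_comm

theorem mem_congr {d d' : D.Dart} (h : D.Conn S d d') : d ∈ W ↔ d' ∈ W := by
  rw [L.mem_iff S hA hB hb, L.mem_iff S hA hB hb]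
  exact ⟨fun h' => h'.trans h, fun h' => h'.trans h.symm⟩

theorem conn_toggle_of_mem {d : D.Dart} (h : d ∈ W) : D.Conn (D.toggle c S) d o := by
  have J := L.joins S hA hB hb
  rw [conn_comm, J.conn_iff_of_near ((L.near_iff hA hB hb).2 (Or.inr (Conn.refl o))),
    L.near_iff hA hB hb]
  exact Or.inl h

theorem conn_toggle_iff {d d' : D.Dart} (h : d ∉ W) (h' : d' ∉ W) :
    D.Conn (D.toggle c S) d d' ↔ D.Conn S d d' := by
  have J := L.joins S hA hB hb
  rw [conn_iff_of_joined J.agree J.conn, L.near_iff hA hB hb, L.near_iff hA hB hb]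
  refine ⟨?_, Or.inl⟩
  rintro (g | ⟨g, g'⟩)
  · exact g
  · exact (g.resolve_left h).trans (g'.resolve_left h').symm

theorem exists_gen_of_toggle (hl : D.loops = 0) {v : ℕ} (hv : v ≤ 1) {t : D.Gen}
    (ht : t.1 = D.toggle c S) :
    ∃ s : D.Gen, s.1 = S ∧ D.lab s p = v ∧ ∀ d ∉ W, D.lab s d = D.lab t d := by
  classical
  obtain ⟨s, hs, hlab⟩ := exists_gen hl S (l := fun d => if d ∈ W then v else D.lab t d)
    (fun d => by
      split_ifs
      exacts [hv, lab_le_one t d])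
    (fun d d' h => by
      have h1 := L.mem_congr hA hB hb h
      by_cases hd : d ∈ W
      · rw [if_pos hd, if_pos (h1.1 hd)]
      · rw [if_neg hd, if_neg fun h => hd (h1.2 h)]
        refine lab_eq_of_conn t ?_
        rw [ht, L.conn_toggle_iff hA hB hb hd fun h => hd (h1.2 h)]
        exact h)
  exact ⟨s, hs, by rw [hlab, if_pos (L.mem_left hA hB hb)], fun d hd => by rw [hlab, if_neg hd]⟩

theorem exists_toggle_gen (hl : D.loops = 0) {s : D.Gen} (hs : s.1 = S) :
    ∃ t : D.Gen, t.1 = D.toggle c S ∧ ∀ d ∉ W, D.lab s d = D.lab t d := by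
  classical
  have key : ∀ d, d ∉ W → D.Conn S d o → D.lab s d = D.lab s o := fun d _ h =>
    lab_eq_of_conn s (by rwa [hs])
  have J := L.joins S hA hB hb
  obtain ⟨t, ht, hlab⟩ := exists_gen hl (D.toggle c S)
    (l := fun d => if d ∈ W then D.lab s o else D.lab s d)
    (fun d => by
      split_ifs <;> exact lab_le_one _ _)
    (fun d d' h => by
      have ho := L.notMem_right hA hB hb
      have h' : ∀ x, x ∉ W → D.Conn (D.toggle c S) x o → D.lab s x = D.lab s o := fun x hx h =>
        key x hx ((L.conn_toggle_iff hA hB hb hx ho).1 h)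
      by_cases hd : d ∈ W
      · have h1 := L.conn_toggle_of_mem hA hB hb hd
        by_cases hd' : d' ∈ W
        · rw [if_pos hd, if_pos hd']
        · rw [if_pos hd, if_neg hd', h' d' hd' (h.symm.trans h1)]
      · by_cases hd' : d' ∈ W
        · have h1 := L.conn_toggle_of_mem hA hB hb hd'
          rw [if_neg hd, if_pos hd', h' d hd (h.trans h1)]
        · rw [if_neg hd, if_neg hd']
          exact lab_eq_of_conn s (by rwa [hs, ← L.conn_toggle_iff hA hB hb hd hd']))
  exact ⟨t, ht, fun d hd => by rw [hlab, if_neg hd]⟩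

theorem gen_eq (hl : D.loops = 0) {s s' : D.Gen} (hs : s.1 = S) (hs' : s'.1 = S)
    (hp : D.lab s p = D.lab s' p) (h : ∀ d ∉ W, D.lab s d = D.lab s' d) : s = s' := by
  refine gen_ext hl (hs.trans hs'.symm) fun d => ?_
  by_cases hd : d ∈ W
  · have h1 := (L.mem_iff S hA hB hb d).1 hd
    rw [← lab_eq_of_conn s (by rwa [hs]), ← lab_eq_of_conn s' (by rwa [hs']), hp]
  · exact h d hd

theorem toggle_gen_eq (hl : D.loops = 0) {t t' : D.Gen} (ht : t.1 = D.toggle c S)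
    (ht' : t'.1 = D.toggle c S) (h : ∀ d ∉ W, D.lab t d = D.lab t' d) : t = t' := by
  refine gen_ext hl (ht.trans ht'.symm) fun d => ?_
  by_cases hd : d ∈ W
  · have h1 := L.conn_toggle_of_mem hA hB hb hd
    rw [lab_eq_of_conn t (by rwa [ht]), lab_eq_of_conn t' (by rwa [ht']),
      h o (L.notMem_right hA hB hb)]
  · exact h d hd

omit hb in
theorem forall_mem_iff {s t : D.Gen} (h1 : s.1 = S) (h2 : t.1 = D.toggle c S) (hb : c ∈ S ↔ b) :
    (∀ d ∉ W, D.lab s d = D.lab t d) ↔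
      (∀ d, ¬ D.Near S c d → D.lab s d = D.lab t d) ∧ D.lab s o = D.lab t (c, 0) := by
  have ho := L.notMem_right hA hB hb
  have e : D.lab t (c, 0) = D.lab t o := by
    have J := L.joins S hA hB hb
    refine lab_eq_of_conn t ?_
    rw [h2, J.conn_iff_of_near (near_self 0), L.near_iff hA hB hb]
    exact Or.inr (Conn.refl o)
  constructor
  · exact fun h => ⟨fun d hd => h d fun hW => hd ((L.near_iff hA hB hb).2 (Or.inl hW)),
      by rw [e, h o ho]⟩
  · rintro ⟨h, h'⟩ d hd
    by_cases hn : D.Near S c d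
    · have hdo := ((L.near_iff hA hB hb).1 hn).resolve_left hd
      rw [lab_eq_of_conn s (show D.Conn s.1 d o by rwa [h1]), h', e]
      refine (lab_eq_of_conn t ?_).symm
      rwa [h2, L.conn_toggle_iff hA hB hb hd ho]
    · exact h d hn

theorem qdeg_toggle (hl : D.loops = 0) {s t : D.Gen} (hs : s.1 = S) (ht : t.1 = D.toggle c S)
    (h : ∀ d ∉ W, D.lab s d = D.lab t d) :
    D.qdeg t = D.qdeg s + (2 * D.lab s p - 1) + (t.1.card - s.1.card) := by
  subst hs
  have J := L.joins s.1 hA hB hb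
  have h' := (L.forall_mem_iff hA hB rfl ht hb).1 h
  rw [← ht] at J
  have := finsum_degree_of_joins hl J h'.1
  unfold qdeg
  rcases L.sides with ⟨rfl, rfl⟩ | ⟨rfl, rfl⟩ <;> have h2 := h'.2 <;> omega

end State

end IsLeaf

theorem dCoeff_insert {s t : D.Gen} (hc : c ∉ s.1) (ht : t.1 = insert c s.1) :
    D.dCoeff s t = D.edgeSign c s.1 * D.edgeCoeff c s t := by
  rw [dCoeff_eq, Finset.sum_eq_single c]
  · rw [edgeMat, if_pos ⟨hc, ht⟩]
  · intro x _ hx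
    rw [edgeMat, if_neg, mul_zero]
    rintro ⟨hx1, hx2⟩
    rw [ht] at hx2
    have := hx2 ▸ Finset.mem_insert_self c s.1
    exact (Finset.mem_insert.1 this).elim (fun h => hx h.symm) hc
  · simp

theorem edgeSign_mul_self (c : Fin D.n) (S : D.State) : D.edgeSign c S * D.edgeSign c S = 1 := by
  unfold edgeSign
  rw [← mul_pow]
  simp

/-- The sign that measures how the smoothing at a crossing changes the signs of the other edges of
the cube. -/
def tailSign (D : LinkDiagram) (c : Fin D.n) (S : D.State) : ℤ :=
  (-1) ^ (S.filter (fun b => c < b)).card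

theorem tailSign_mul_self (c : Fin D.n) (S : D.State) : D.tailSign c S * D.tailSign c S = 1 := by
  unfold tailSign
  rw [← mul_pow]
  simp

theorem edgeSign_toggle {x : Fin D.n} (hx : x ∉ S) :
    D.edgeSign x S =
      D.tailSign c S * D.tailSign c (insert x S) * D.edgeSign x (D.toggle c S) := by
  have h1 : D.tailSign c (insert x S) = (if c < x then -1 else 1) * D.tailSign c S := by
    unfold tailSign
    rw [Finset.filter_insert]
    split_ifs
    · rw [Finset.card_insert_of_notMem (by simp [hx]), pow_succ]; ring
    · ring
  have h2 : ∀ S : D.State, c ∉ S →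
      D.edgeSign x (insert c S) = (if c < x then -1 else 1) * D.edgeSign x S := by
    intro S hc
    unfold edgeSign
    rw [Finset.filter_insert]
    split_ifs
    · rw [Finset.card_insert_of_notMem (by simp [hc]), pow_succ]; ring
    · ring
  have h3 := tailSign_mul_self c S
  have h4 : D.edgeSign x S = (if c < x then -1 else 1) * D.edgeSign x (D.toggle c S) := by
    by_cases hc : c ∈ S
    · obtain ⟨R, hR, rfl⟩ : ∃ R, c ∉ R ∧ insert c R = S :=
        ⟨S.erase c, Finset.notMem_erase _ _, Finset.insert_erase hc⟩
      rw [toggle_insert_self hR, h2 R hR]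
    · rw [toggle_of_notMem hc, h2 S hc]
      split_ifs <;> ring
  rw [h1, h4]
  linear_combination (-(if c < x then -1 else 1) * D.edgeSign x (D.toggle c S)) * h3

namespace IsLeaf

variable {p o : D.Dart} {b : Prop} {W : Set D.Dart} (L : D.IsLeaf A B c p o b W)
include L

/-- Forgetting a circle that is not touched by the other crossings respects the differential. -/
theorem dCoeff_toggle (hl : D.loops = 0) {s s' t t' : D.Gen}
    (hA : A ⊆ s.1) (hB : s.1 ⊆ B) (hb : c ∈ s.1 ↔ b)
    (hA' : A ⊆ s'.1) (hB' : s'.1 ⊆ B) (hb' : c ∈ s'.1 ↔ b)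
    (ht : t.1 = D.toggle c s.1) (ht' : t'.1 = D.toggle c s'.1)
    (hst : ∀ d ∉ W, D.lab s d = D.lab t d) (hst' : ∀ d ∉ W, D.lab s' d = D.lab t' d)
    (hp : D.lab s p = D.lab s' p) :
    D.dCoeff s s' = D.tailSign c s.1 * D.tailSign c s'.1 * D.dCoeff t t' := by
  classical
  rw [dCoeff_eq, dCoeff_eq, Finset.mul_sum]
  refine Finset.sum_congr rfl fun x _ => ?_
  have hcond : (x ∉ s.1 ∧ s'.1 = insert x s.1) ↔ (x ∉ t.1 ∧ t'.1 = insert x t.1) := by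
    rw [ht, ht']
    by_cases hx : x = c
    · subst hx
      constructor
      · rintro ⟨h1, h2⟩
        exact absurd (hb.2 (hb'.1 (by rw [h2]; exact Finset.mem_insert_self _ _))) h1
      · rintro ⟨h1, h2⟩
        have := mem_toggle_self.1 (h2 ▸ Finset.mem_insert_self x (D.toggle x s.1))
        rw [mem_toggle_self, not_not] at h1
        exact absurd (hb'.2 (hb.1 h1)) this
    · rw [mem_toggle_of_ne hx]
      refine and_congr_right fun _ => ?_
      constructor <;> intro h <;> ext y <;> have h' := Finset.ext_iff.1 h y <;>
        by_cases hy : y = c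
      · subst hy
        rw [Finset.mem_insert, mem_toggle_self, mem_toggle_self, hb, hb']
        simp [Ne.symm hx]
      · rw [mem_toggle_of_ne hy, Finset.mem_insert, mem_toggle_of_ne hy, h', Finset.mem_insert]
      · subst hy
        rw [Finset.mem_insert, hb, hb']
        simp [Ne.symm hx]
      · rwa [mem_toggle_of_ne hy, Finset.mem_insert, mem_toggle_of_ne hy, ← Finset.mem_insert] at h'
  by_cases hx : x ∉ s.1 ∧ s'.1 = insert x s.1
  swap
  · rw [edgeMat, if_neg hx, edgeMat, if_neg fun h => hx (hcond.2 h)]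
    ring
  have hxc : x ≠ c := by
    rintro rfl
    exact hx.1 (hb.2 (hb'.1 (by rw [hx.2]; exact Finset.mem_insert_self _ _)))
  have hxlive : x ∈ B \ A := Finset.mem_sdiff.2
    ⟨hB' (by rw [hx.2]; exact Finset.mem_insert_self _ _), fun h => hx.1 (hA h)⟩
  have hxW : ∀ k, ((x, k) : D.Dart) ∉ W := fun k h => hxc (L.live _ h hxlive)
  have ho := L.notMem_right hA hB hb
  have hnear : ∀ d ∉ W, (D.Near t.1 x d ↔ D.Near s.1 x d) := by
    intro d hd
    unfold Near
    rw [ht, L.conn_toggle_iff hA hB hb hd (hxW 0), L.conn_toggle_iff hA hB hb hd (hxW 2)]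
  have hagree : (∀ d, ¬ D.Near s.1 x d → D.lab s d = D.lab s' d) ↔
      ∀ d, ¬ D.Near t.1 x d → D.lab t d = D.lab t' d := by
    constructor <;> intro h d hd <;> by_cases hW : d ∈ W
    · have h1 := L.conn_toggle_of_mem hA hB hb hW
      have h2 := L.conn_toggle_of_mem hA' hB' hb' hW
      rw [← ht] at h1
      rw [← ht'] at h2
      rw [lab_eq_of_conn t h1, lab_eq_of_conn t' h2, ← hst o ho, ← hst' o ho]
      refine h o fun hn => hd ?_
      exact ((hnear o ho).2 hn).of_conn h1
    · rw [← hst d hW, ← hst' d hW]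
      exact h d fun hn => hd ((hnear d hW).2 hn)
    · rw [← lab_eq_of_conn s ((L.mem_iff _ hA hB hb d).1 hW),
        ← lab_eq_of_conn s' ((L.mem_iff _ hA' hB' hb' d).1 hW), hp]
    · rw [hst d hW, hst' d hW]
      exact h d fun hn => hd ((hnear d hW).1 hn)
  have hcoeff : D.edgeCoeff x s s' = D.edgeCoeff x t t' := by
    have h02 : D.Conn t.1 (x, 0) (x, 2) ↔ D.Conn s.1 (x, 0) (x, 2) := by
      rw [ht, L.conn_toggle_iff hA hB hb (hxW 0) (hxW 2)]
    by_cases h : D.Conn s.1 (x, 0) (x, 2)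
    · rw [edgeCoeff_of_conn hl h, edgeCoeff_of_conn hl (h02.2 h), hst _ (hxW 0), hst' _ (hxW 0),
        hst' _ (hxW 2)]
      exact if_congr (and_congr_left' hagree) rfl rfl
    · rw [edgeCoeff_of_not_conn hl h, edgeCoeff_of_not_conn hl fun h' => h (h02.1 h'),
        hst _ (hxW 0), hst _ (hxW 2), hst' _ (hxW 0)]
      exact if_congr (and_congr_left' hagree) rfl rfl
  rw [edgeMat, if_pos hx, edgeMat, if_pos (hcond.1 hx), hcoeff, edgeSign_toggle (c := c) hx.1, hx.2, ht]
  ring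

/-- Deleting the circle `W` gives an isomorphism of subquotient complexes. -/
theorem exactOn_iff (hl : D.loops = 0) {v : ℕ} (hv : v ≤ 1) {a : ℤ}
    (hAc : c ∉ A) (hcB : c ∈ B)
    (ha : ∀ S, (c ∈ S ↔ b) → ((D.toggle c S).card : ℤ) = S.card + a)
    (hav : a = 2 * v - 1) (i j : ℤ) :
    ExactOn D.dCoeff D.hdeg D.qdeg {s | A ⊆ s.1 ∧ s.1 ⊆ B ∧ (c ∈ s.1 ↔ b) ∧ D.lab s p = v} i j ↔
    ExactOn D.dCoeff D.hdeg D.qdeg {s | A ⊆ s.1 ∧ s.1 ⊆ B ∧ (c ∈ s.1 ↔ ¬ b)} (i + a) (j + 2 * a)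
    := by
  classical
  have htA : ∀ S : D.State, A ⊆ S → A ⊆ D.toggle c S := fun S h x hx =>
    (mem_toggle_of_ne fun e => hAc (by rwa [← e])).2 (h hx)
  have htB : ∀ S : D.State, S ⊆ B → D.toggle c S ⊆ B := fun S h x hx => by
    by_cases e : x = c
    · rwa [e]
    · exact h ((mem_toggle_of_ne e).1 hx)
  set Q : Set D.Gen := {s | A ⊆ s.1 ∧ s.1 ⊆ B ∧ (c ∈ s.1 ↔ b) ∧ D.lab s p = v} with hQ
  set Q' : Set D.Gen := {s | A ⊆ s.1 ∧ s.1 ⊆ B ∧ (c ∈ s.1 ↔ ¬ b)} with hQ'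
  have e1 : ∀ s ∈ Q, ∃ t : D.Gen, t.1 = D.toggle c s.1 ∧ ∀ d ∉ W, D.lab s d = D.lab t d :=
    fun s hs => L.exists_toggle_gen hs.1 hs.2.1 hs.2.2.1 hl rfl
  have hb' : ∀ t : D.Gen, t ∈ Q' → (c ∈ D.toggle c t.1 ↔ b) := fun t ht => by
    rw [mem_toggle_self, ht.2.2, not_not]
  have e2 : ∀ t ∈ Q', ∃ s : D.Gen, s.1 = D.toggle c t.1 ∧ D.lab s p = v ∧
      ∀ d ∉ W, D.lab s d = D.lab t d := fun t ht =>
    L.exists_gen_of_toggle (htA _ ht.1) (htB _ ht.2.1) (hb' t ht) hl hv (toggle_toggle c t.1).symm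
  choose! φ hφ1 hφ2 using e1
  choose! ψ hψ1 hψ2 hψ3 using e2
  have hφQ : ∀ s ∈ Q, φ s ∈ Q' := fun s hs =>
    ⟨by rw [hφ1 s hs]; exact htA _ hs.1, by rw [hφ1 s hs]; exact htB _ hs.2.1,
      by rw [hφ1 s hs, mem_toggle_self, hs.2.2.1]⟩
  have hψQ : ∀ t ∈ Q', ψ t ∈ Q := fun t ht =>
    ⟨by rw [hψ1 t ht]; exact htA _ ht.1, by rw [hψ1 t ht]; exact htB _ ht.2.1,
      by rw [hψ1 t ht]; exact hb' t ht, hψ2 t ht⟩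
  have hφψ : ∀ s ∈ Q, φ s ∈ Q' ∧ ψ (φ s) = s := by
    intro s hs
    refine ⟨hφQ s hs, L.gen_eq hs.1 hs.2.1 hs.2.2.1 hl ?_ rfl ?_ ?_⟩
    · rw [hψ1 _ (hφQ s hs), hφ1 s hs, toggle_toggle]
    · rw [hψ2 _ (hφQ s hs), hs.2.2.2]
    · intro d hd
      rw [hψ3 _ (hφQ s hs) d hd, hφ2 s hs d hd]
  have hψφ : ∀ t ∈ Q', ψ t ∈ Q ∧ φ (ψ t) = t := by
    intro t ht
    have h := hψQ t ht
    refine ⟨h, L.toggle_gen_eq h.1 h.2.1 h.2.2.1 hl (hφ1 _ h) ?_ ?_⟩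
    · rw [hψ1 t ht, toggle_toggle]
    · intro d hd
      rw [← hφ2 _ h d hd, hψ3 t ht d hd]
  have hM : ∀ s ∈ Q, ∀ t ∈ Q, D.dCoeff s t =
      D.tailSign c s.1 * D.tailSign c t.1 * D.dCoeff (φ s) (φ t) := fun s hs t ht =>
    L.dCoeff_toggle hl hs.1 hs.2.1 hs.2.2.1 ht.1 ht.2.1 ht.2.2.1 (hφ1 s hs) (hφ1 t ht)
      (hφ2 s hs) (hφ2 t ht) (hs.2.2.2.trans ht.2.2.2.symm)
  have hh : ∀ s ∈ Q, D.hdeg (φ s) = D.hdeg s + a := fun s hs => by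
    unfold hdeg
    rw [hφ1 s hs, ha _ hs.2.2.1]
  have hq : ∀ s ∈ Q, D.qdeg (φ s) = D.qdeg s + 2 * a := fun s hs => by
    have h1 := L.qdeg_toggle hs.1 hs.2.1 hs.2.2.1 hl rfl (hφ1 s hs) (hφ2 s hs)
    rw [hφ1 s hs, ha _ hs.2.2.1, hs.2.2.2] at h1
    rw [h1, hav]
    ring
  constructor
  · exact ExactOn.of_equiv φ ψ (fun s => D.tailSign c s.1) hφψ hψφ
      (fun s => tailSign_mul_self c s.1) hM hh hq rfl rfl
  · refine ExactOn.of_equiv (a := -a) (b := -(2 * a)) ψ φ (fun t => D.tailSign c (ψ t).1) hψφ hφψ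
      (fun s => tailSign_mul_self c _) ?_ ?_ ?_ (by ring) (by ring)
    · intro s hs t ht
      rw [hM _ (hψφ s hs).1 _ (hψφ t ht).1, (hψφ s hs).2, (hψφ t ht).2]
      have h1 := tailSign_mul_self c (ψ s).1
      have h2 := tailSign_mul_self c (ψ t).1
      linear_combination (-D.dCoeff s t * D.tailSign c (ψ t).1 * D.tailSign c (ψ t).1) * h1
        - D.dCoeff s t * h2
    · intro t ht
      have := hh _ (hψφ t ht).1
      rw [(hψφ t ht).2] at this
      omega
    · intro t ht
      have := hq _ (hψφ t ht).1
      rw [(hψφ t ht).2] at this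
      omega

end IsLeaf

end LinkDiagram

namespace LinkDiagram

open BasedComplex

variable {D : LinkDiagram} {A B S S' : D.State} {c : Fin D.n}

/-- The generators that belong to the states in an interval. -/
def ivl (D : LinkDiagram) (A B : D.State) : Set D.Gen := {s | A ⊆ s.1 ∧ s.1 ⊆ B}

theorem dCoeff_subset {s t : D.Gen} (h : D.dCoeff s t ≠ 0) : s.1 ⊆ t.1 := by
  obtain ⟨c, -, ht, -⟩ := dCoeff_ne_zero h
  rw [ht]
  exact Finset.subset_insert _ _

theorem convex_ivl (A B : D.State) : Convex D.dCoeff (D.ivl A B) := fun _ hs _ hu _ h1 h2 =>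
  ⟨hs.1.trans (dCoeff_subset h1), (dCoeff_subset h2).trans hu.2⟩

theorem ivl_insert (A B : D.State) (c : Fin D.n) :
    D.ivl (insert c A) B = {s | A ⊆ s.1 ∧ s.1 ⊆ B ∧ c ∈ s.1} := by
  ext s
  simp only [ivl, Set.mem_ofPred_eq, Finset.insert_subset_iff]
  tauto

theorem ivl_erase (A B : D.State) (c : Fin D.n) :
    D.ivl A (B.erase c) = {s | A ⊆ s.1 ∧ s.1 ⊆ B ∧ c ∉ s.1} := by
  ext s
  simp only [ivl, Set.mem_ofPred_eq, Finset.subset_erase]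

theorem splits_ivl (A B : D.State) (c : Fin D.n) :
    Splits D.dCoeff (D.ivl A B) (D.ivl (insert c A) B) (D.ivl A (B.erase c)) where
  convex := convex_ivl A B
  union := by
    rw [ivl_insert, ivl_erase]
    ext s
    simp only [ivl, Set.mem_ofPred_eq, Set.mem_union]
    tauto
  disj := by
    rw [ivl_insert, ivl_erase]
    exact Set.disjoint_left.2 fun s h h' => h'.2.2 h.2.2
  zero := fun u hu v hv => by
    rw [ivl_insert] at hu
    rw [ivl_erase] at hv
    by_contra h
    exact hv.2.2 (dCoeff_subset h hu.2.2)

section Thin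

/-- The homology of the subquotient spanned by `Q` lies on two diagonals, it does not vanish on the
lower one in the smallest primary degree, and it does not vanish on the upper one in the largest
primary degree in which there is homology. -/
def Thin (D : LinkDiagram) (m : ℤ) (Q : Set D.Gen) : Prop :=
  ∃ a b : ℤ, (∀ i j, ¬ ExactOn D.dCoeff D.hdeg D.qdeg Q i j →
      a ≤ i ∧ i ≤ b ∧ (j = 2 * i - m - 1 ∨ j = 2 * i - m + 1)) ∧
    ¬ ExactOn D.dCoeff D.hdeg D.qdeg Q a (2 * a - m - 1) ∧
    ¬ ExactOn D.dCoeff D.hdeg D.qdeg Q b (2 * b - m + 1)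

variable {m : ℤ} {Q U V : Set D.Gen}

theorem Thin.of_splits (hM : IsDiff D.dCoeff D.hdeg D.qdeg) (H : Splits D.dCoeff Q U V)
    (hU : D.Thin m U) (hV : D.Thin m V) : D.Thin m Q := by
  obtain ⟨a₁, b₁, h₁, l₁, u₁⟩ := hU
  obtain ⟨a₀, b₀, h₀, l₀, u₀⟩ := hV
  have e₁ : ∀ i j, ¬ (a₁ ≤ i ∧ i ≤ b₁ ∧ (j = 2 * i - m - 1 ∨ j = 2 * i - m + 1)) →
      ExactOn D.dCoeff D.hdeg D.qdeg U i j := fun i j h => by_contra fun h' => h (h₁ i j h')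
  have e₀ : ∀ i j, ¬ (a₀ ≤ i ∧ i ≤ b₀ ∧ (j = 2 * i - m - 1 ∨ j = 2 * i - m + 1)) →
      ExactOn D.dCoeff D.hdeg D.qdeg V i j := fun i j h => by_contra fun h' => h (h₀ i j h')
  refine ⟨min a₁ a₀, max b₁ b₀, fun i j h => ?_, ?_, ?_⟩
  · by_cases g : ExactOn D.dCoeff D.hdeg D.qdeg U i j
    · obtain ⟨g1, g2, g3⟩ := h₀ i j fun g' => h (H.exactOn hM g g')
      exact ⟨(min_le_right _ _).trans g1, g2.trans (le_max_right _ _), g3⟩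
    · obtain ⟨g1, g2, g3⟩ := h₁ i j g
      exact ⟨(min_le_left _ _).trans g1, g2.trans (le_max_left _ _), g3⟩
  · rcases le_or_gt a₁ a₀ with h | h
    · rw [min_eq_left h]
      exact fun g => l₁ (H.exactOn_left hM g (e₀ _ _ (by omega)))
    · rw [min_eq_right h.le]
      exact fun g => l₀ (H.exactOn_right hM g (e₁ _ _ (by omega)))
  · rcases le_or_gt b₁ b₀ with h | h
    · rw [max_eq_right h]
      exact fun g => u₀ (H.exactOn_right hM g (e₁ _ _ (by omega)))
    · rw [max_eq_left h.le]
      exact fun g => u₁ (H.exactOn_left hM g (e₀ _ _ (by omega)))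

theorem Thin.of_shift {Q' : Set D.Gen} {a : ℤ}
    (H : ∀ i j, ExactOn D.dCoeff D.hdeg D.qdeg Q i j ↔
      ExactOn D.dCoeff D.hdeg D.qdeg Q' (i + a) (j + 2 * a)) (h : D.Thin m Q') : D.Thin m Q := by
  obtain ⟨l, u, h1, h2, h3⟩ := h
  refine ⟨l - a, u - a, fun i j hij => ?_, ?_, ?_⟩
  · rw [H] at hij
    have := h1 _ _ hij
    omega
  · rw [H]
    convert h2 using 2 <;> ring
  · rw [H]
    convert h3 using 2 <;> ring

end Thin

section Leaf

namespace IsLeaf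

variable {p o : D.Dart} {b : Prop} {W : Set D.Dart}

theorem lab_eq_of_dCoeff_ne_zero (L : D.IsLeaf A B c p o b W) {s t : D.Gen} (hA : A ⊆ s.1)
    (hB : t.1 ⊆ B) (hs : c ∈ s.1 ↔ b) (ht : c ∈ t.1 ↔ b) (h : D.dCoeff s t ≠ 0) :
    D.lab s p = D.lab t p := by
  have hsB := (dCoeff_subset h).trans hB
  obtain ⟨x, hx, hxt, hne⟩ := dCoeff_ne_zero h
  have hag : D.AgreeAway x s t := by
    by_contra h'
    exact hne (if_neg h')
  refine hag.1 p fun k hk => ?_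
  have hxW : ((x, k) : D.Dart) ∈ W := (L.mem_iff _ hA hsB hs _).2 hk
  have hxt' : x ∈ t.1 := by rw [hxt]; exact Finset.mem_insert_self _ _
  obtain rfl : x = c := L.live _ hxW (Finset.mem_sdiff.2 ⟨hB hxt', fun h => hx (hA h)⟩)
  exact hx (hs.2 (ht.1 hxt'))

theorem lab_zero_add_lab_two (L : D.IsLeaf A B c p o b W) (s : D.Gen) :
    D.lab s (c, 0) + D.lab s (c, 2) = D.lab s p + D.lab s o := by
  rcases L.sides with ⟨rfl, rfl⟩ | ⟨rfl, rfl⟩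
  exacts [rfl, add_comm _ _]

open scoped Classical in
theorem edgeCoeff_bridge (L : D.IsLeaf A B c p o False W) (hl : D.loops = 0) {s t : D.Gen}
    (hA : A ⊆ s.1) (hB : s.1 ⊆ B) (hc : c ∉ s.1) (ht : t.1 = insert c s.1) (hp : D.lab s p = 0) :
    D.edgeCoeff c s t = if ∀ d ∉ W, D.lab s d = D.lab t d then 1 else 0 := by
  have hb : c ∈ s.1 ↔ False := by simp [hc]
  rw [edgeCoeff_of_not_conn hl (L.joins _ hA hB hb).not_conn]
  refine if_congr ?_ rfl rfl
  rw [L.forall_mem_iff hA hB rfl (ht.trans (toggle_of_notMem hc).symm) hb,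
    L.lab_zero_add_lab_two, hp, zero_add]

open scoped Classical in
theorem edgeCoeff_loop (L : D.IsLeaf A B c p o True W) (hl : D.loops = 0) {s t : D.Gen}
    (hA : A ⊆ t.1) (hB : t.1 ⊆ B) (hc : c ∉ s.1) (ht : t.1 = insert c s.1) (hp : D.lab t p = 1) :
    D.edgeCoeff c s t = if ∀ d ∉ W, D.lab t d = D.lab s d then 1 else 0 := by
  have hb : c ∈ t.1 ↔ True := by simp [ht]
  have hs : s.1 = D.toggle c t.1 := by rw [ht, toggle_insert_self hc]
  have J := L.joins _ hA hB hb
  rw [← hs] at J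
  rw [edgeCoeff_of_conn hl J.conn]
  refine if_congr ?_ rfl rfl
  rw [L.forall_mem_iff hA hB rfl hs hb, L.lab_zero_add_lab_two, hp, add_comm 1, add_left_inj]
  refine and_congr_left' (forall_congr' fun d => ?_)
  rw [J.near_iff, eq_comm]

theorem eq_of_dCoeff_ne_zero {s t : D.Gen} (hs : c ∉ s.1) (ht : c ∈ t.1) (h : D.dCoeff s t ≠ 0) :
    t.1 = insert c s.1 ∧ D.edgeCoeff c s t ≠ 0 := by
  obtain ⟨x, -, hxt, hne⟩ := dCoeff_ne_zero h
  obtain rfl : c = x := (Finset.mem_insert.1 (hxt ▸ ht)).resolve_right hs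
  exact ⟨hxt, hne⟩

theorem thin_of_bridge (L : D.IsLeaf A B c p o False W) (hl : D.loops = 0)
    (hM : IsDiff D.dCoeff D.hdeg D.qdeg) (hcA : c ∉ A) (hcB : c ∈ B) {m : ℤ}
    (H : D.Thin m (D.ivl (insert c A) B)) : D.Thin m (D.ivl A B) := by
  classical
  set V : Set D.Gen := {s | A ⊆ s.1 ∧ s.1 ⊆ B ∧ (c ∈ s.1 ↔ False) ∧ D.lab s p = 1} with hV
  set U₀ : Set D.Gen := {s | A ⊆ s.1 ∧ s.1 ⊆ B ∧ (c ∈ s.1 ↔ False) ∧ D.lab s p = 0} with hU₀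
  set U₁ : Set D.Gen := {s | A ⊆ s.1 ∧ s.1 ⊆ B ∧ c ∈ s.1} with hU₁
  have split : Splits D.dCoeff (D.ivl A B) (U₁ ∪ U₀) V := by
    refine ⟨convex_ivl A B, ?_, ?_, ?_⟩
    · ext s
      have := lab_le_one s p
      have h01 : D.lab s p = 0 ∨ D.lab s p = 1 := by omega
      simp only [ivl, hV, hU₀, hU₁, Set.mem_ofPred_eq, Set.mem_union]
      tauto
    · refine Set.disjoint_left.2 fun s h h' => ?_
      rcases h with h | h
      · exact h'.2.2.1.1 h.2.2
      · have h1 := h.2.2.2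
        have h2 := h'.2.2.2
        omega
    · intro u hu v hv
      by_contra h
      rcases hu with hu | hu
      · exact hv.2.2.1.1 (dCoeff_subset h hu.2.2)
      · have h1 := L.lab_eq_of_dCoeff_ne_zero hu.1 hv.2.1 hu.2.2.1 hv.2.2.1 h
        have h2 := hu.2.2.2
        have h3 := hv.2.2.2
        omega
  have split' : Splits D.dCoeff (U₁ ∪ U₀) U₁ U₀ := by
    refine ⟨split.convex_left, rfl, Set.disjoint_left.2 fun s h h' => h'.2.2.1.1 h.2.2, ?_⟩
    intro u hu v hv
    by_contra h
    exact hv.2.2.1.1 (dCoeff_subset h hu.2.2)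
  have hcoeff : ∀ s ∈ U₀, ∀ t ∈ U₁, t.1 = insert c s.1 → D.dCoeff s t = D.edgeSign c s.1 *
      if ∀ d ∉ W, D.lab s d = D.lab t d then 1 else 0 := fun s hs t ht h => by
    have hc : c ∉ s.1 := hs.2.2.1.1
    rw [dCoeff_insert hc h, L.edgeCoeff_bridge hl hs.1 hs.2.1 hc h hs.2.2.2]
  have hrel : ∀ s ∈ U₀, ∀ t ∈ U₁, D.dCoeff s t ≠ 0 →
      t.1 = insert c s.1 ∧ ∀ d ∉ W, D.lab s d = D.lab t d := fun s hs t ht h => by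
    have h1 := (eq_of_dCoeff_ne_zero (fun h => hs.2.2.1.1 h) ht.2.2 h).1
    refine ⟨h1, by_contra fun h2 => h ?_⟩
    rw [hcoeff s hs t ht h1, if_neg h2, mul_zero]
  have hsq : ∀ s ∈ U₀, ∀ t ∈ U₁, t.1 = insert c s.1 → (∀ d ∉ W, D.lab s d = D.lab t d) →
      D.dCoeff s t * D.dCoeff s t = 1 := fun s hs t ht h h' => by
    rw [hcoeff s hs t ht h, if_pos h', mul_one, edgeSign_mul_self]
  have acyclic : ∀ i j, ExactOn D.dCoeff D.hdeg D.qdeg (U₁ ∪ U₀) i j := by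
    refine split'.exactOn_of_matching hM (fun s hs => ?_) fun t ht => ?_
    · obtain ⟨t, ht, hlab⟩ := L.exists_toggle_gen hs.1 hs.2.1 hs.2.2.1 hl rfl
      rw [toggle_of_notMem fun h => hs.2.2.1.1 h] at ht
      have htU : t ∈ U₁ := ⟨by rw [ht]; exact hs.1.trans (Finset.subset_insert _ _),
        by rw [ht]; exact Finset.insert_subset hcB hs.2.1, by rw [ht]; exact Finset.mem_insert_self _ _⟩
      refine ⟨t, htU, fun h => ?_, fun s' hs' hne => by_contra fun h => hne ?_⟩
      · have := hsq s hs t htU ht hlab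
        rw [h] at this
        simp at this
      · obtain ⟨h1, h2⟩ := hrel s' hs' t htU h
        have e : s'.1 = s.1 := by
          rw [← Finset.erase_insert (a := c) (s := s.1) fun h => hs.2.2.1.1 h, ← ht, h1,
            Finset.erase_insert fun h => hs'.2.2.1.1 h]
        exact L.gen_eq hs.1 hs.2.1 hs.2.2.1 hl e rfl (hs'.2.2.2.trans hs.2.2.2.symm)
          fun d hd => by rw [h2 d hd, hlab d hd]
    · have hRA : A ⊆ t.1.erase c := fun x hx =>
        Finset.mem_erase.2 ⟨fun e => hcA (by rwa [← e]), ht.1 hx⟩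
      have hRB : t.1.erase c ⊆ B := (Finset.erase_subset _ _).trans ht.2.1
      have hRb : c ∈ t.1.erase c ↔ False := by simp
      have hins : t.1 = insert c (t.1.erase c) := (Finset.insert_erase ht.2.2).symm
      obtain ⟨s, hs, hp, hlab⟩ := L.exists_gen_of_toggle hRA hRB hRb hl (v := 0) (by omega) (t := t)
        (by rw [toggle_of_notMem (Finset.notMem_erase _ _)]; exact hins)
      have hsU : s ∈ U₀ := ⟨by rwa [hs], by rwa [hs], by rwa [hs], hp⟩
      rw [← hs] at hins hRA hRB hRb
      refine ⟨s, hsU, hsq s hsU t ht hins hlab, fun t' ht' hne => by_contra fun h => hne ?_⟩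
      obtain ⟨h1, h2⟩ := hrel s hsU t' ht' h
      rw [← toggle_of_notMem fun h => hRb.1 h] at h1 hins
      exact L.toggle_gen_eq hRA hRB hRb hl h1 hins fun d hd => by rw [← h2 d hd, hlab d hd]
  refine Thin.of_shift (Q' := D.ivl (insert c A) B) (a := 1) (fun i j => ?_) H
  rw [split.exactOn_iff_right hM acyclic, hV, L.exactOn_iff hl (v := 1) le_rfl (a := 1) hcA hcB
    (fun S hS => ?_) (by norm_num), ivl_insert]
  · simp only [not_false_eq_true, iff_true]
  · have hcS : c ∉ S := fun h => hS.1 h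
    rw [toggle_of_notMem hcS, Finset.card_insert_of_notMem hcS]
    push_cast
    rfl

theorem thin_of_loop (L : D.IsLeaf A B c p o True W) (hl : D.loops = 0)
    (hM : IsDiff D.dCoeff D.hdeg D.qdeg) (hcA : c ∉ A) (hcB : c ∈ B) {m : ℤ}
    (H : D.Thin m (D.ivl A (B.erase c))) : D.Thin m (D.ivl A B) := by
  classical
  set V : Set D.Gen := {s | A ⊆ s.1 ∧ s.1 ⊆ B ∧ (c ∈ s.1 ↔ True) ∧ D.lab s p = 0} with hV
  set U₁ : Set D.Gen := {s | A ⊆ s.1 ∧ s.1 ⊆ B ∧ (c ∈ s.1 ↔ True) ∧ D.lab s p = 1} with hU₁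
  set U₀ : Set D.Gen := {s | A ⊆ s.1 ∧ s.1 ⊆ B ∧ c ∉ s.1} with hU₀
  have split : Splits D.dCoeff (D.ivl A B) V (U₁ ∪ U₀) := by
    refine ⟨convex_ivl A B, ?_, ?_, ?_⟩
    · ext s
      have := lab_le_one s p
      have h01 : D.lab s p = 0 ∨ D.lab s p = 1 := by omega
      simp only [ivl, hV, hU₀, hU₁, Set.mem_ofPred_eq, Set.mem_union]
      tauto
    · refine Set.disjoint_left.2 fun s h' h => ?_
      rcases h with h | h
      · have h1 := h.2.2.2
        have h2 := h'.2.2.2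
        omega
      · exact h.2.2 (h'.2.2.1.2 trivial)
    · intro u hu v hv
      by_contra h
      rcases hv with hv | hv
      · have h1 := L.lab_eq_of_dCoeff_ne_zero hu.1 hv.2.1 hu.2.2.1 hv.2.2.1 h
        have h2 := hu.2.2.2
        have h3 := hv.2.2.2
        omega
      · exact hv.2.2 (dCoeff_subset h (hu.2.2.1.2 trivial))
  have split' : Splits D.dCoeff (U₁ ∪ U₀) U₁ U₀ := by
    refine ⟨split.convex_right, rfl,
      Set.disjoint_left.2 fun s h h' => h'.2.2 (h.2.2.1.2 trivial), ?_⟩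
    intro u hu v hv
    by_contra h
    exact hv.2.2 (dCoeff_subset h (hu.2.2.1.2 trivial))
  have hcoeff : ∀ s ∈ U₀, ∀ t ∈ U₁, t.1 = insert c s.1 → D.dCoeff s t = D.edgeSign c s.1 *
      if ∀ d ∉ W, D.lab t d = D.lab s d then 1 else 0 := fun s hs t ht h => by
    rw [dCoeff_insert hs.2.2 h, L.edgeCoeff_loop hl ht.1 ht.2.1 hs.2.2 h ht.2.2.2]
  have hrel : ∀ s ∈ U₀, ∀ t ∈ U₁, D.dCoeff s t ≠ 0 →
      t.1 = insert c s.1 ∧ ∀ d ∉ W, D.lab t d = D.lab s d := fun s hs t ht h => by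
    have h1 := (eq_of_dCoeff_ne_zero hs.2.2 (ht.2.2.1.2 trivial) h).1
    refine ⟨h1, by_contra fun h2 => h ?_⟩
    rw [hcoeff s hs t ht h1, if_neg h2, mul_zero]
  have hsq : ∀ s ∈ U₀, ∀ t ∈ U₁, t.1 = insert c s.1 → (∀ d ∉ W, D.lab t d = D.lab s d) →
      D.dCoeff s t * D.dCoeff s t = 1 := fun s hs t ht h h' => by
    rw [hcoeff s hs t ht h, if_pos h', mul_one, edgeSign_mul_self]
  have acyclic : ∀ i j, ExactOn D.dCoeff D.hdeg D.qdeg (U₁ ∪ U₀) i j := by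
    refine split'.exactOn_of_matching hM (fun s hs => ?_) fun t ht => ?_
    · have hSA : A ⊆ insert c s.1 := hs.1.trans (Finset.subset_insert _ _)
      have hSB : insert c s.1 ⊆ B := Finset.insert_subset hcB hs.2.1
      have hSb : c ∈ insert c s.1 ↔ True := by simp
      obtain ⟨t, ht, hp, hlab⟩ := L.exists_gen_of_toggle hSA hSB hSb hl (v := 1) le_rfl (t := s)
        (toggle_insert_self hs.2.2).symm
      have htU : t ∈ U₁ := ⟨by rwa [ht], by rwa [ht], by rwa [ht], hp⟩
      refine ⟨t, htU, fun h => ?_, fun s' hs' hne => by_contra fun h => hne ?_⟩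
      · have := hsq s hs t htU ht hlab
        rw [h] at this
        simp at this
      · obtain ⟨h1, h2⟩ := hrel s' hs' t htU h
        refine L.toggle_gen_eq hSA hSB hSb hl ?_ (toggle_insert_self hs.2.2).symm
          fun d hd => by rw [← h2 d hd, hlab d hd]
        rw [← ht, h1, toggle_insert_self hs'.2.2]
    · obtain ⟨s, hs, hlab⟩ := L.exists_toggle_gen ht.1 ht.2.1 ht.2.2.1 hl rfl
      have hcs : c ∉ s.1 := by
        rw [hs, mem_toggle_self, not_not]
        exact ht.2.2.1.2 trivial
      have hts : t.1 = insert c s.1 := by rw [← toggle_of_notMem hcs, hs, toggle_toggle]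
      have hsU : s ∈ U₀ := by
        refine ⟨fun x hx => ?_, fun x hx => ?_, hcs⟩
        · rw [hs, mem_toggle_of_ne fun e => hcA (by rwa [← e])]
          exact ht.1 hx
        · exact ht.2.1 (by rw [hts]; exact Finset.mem_insert_of_mem hx)
      refine ⟨s, hsU, hsq s hsU t ht hts hlab, fun t' ht' hne => by_contra fun h => hne ?_⟩
      obtain ⟨h1, h2⟩ := hrel s hsU t' ht' h
      exact L.gen_eq ht.1 ht.2.1 ht.2.2.1 hl (h1.trans hts.symm) rfl
        (ht'.2.2.2.trans ht.2.2.2.symm) fun d hd => by rw [h2 d hd, hlab d hd]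
  refine Thin.of_shift (Q' := D.ivl A (B.erase c)) (a := -1) (fun i j => ?_) H
  rw [split.exactOn_iff_left hM acyclic, hV, L.exactOn_iff hl (v := 0) (by omega) (a := -1) hcA hcB
    (fun S hS => ?_) (by norm_num), ivl_erase]
  · simp only [not_true_eq_false, iff_false]
  · have hcS : c ∈ S := hS.2 trivial
    have := Finset.card_erase_add_one hcS
    rw [toggle, if_pos hcS]
    omega

end IsLeaf

theorem exists_isLeaf (hl : D.loops = 0) (halt : D.IsAlternating) {T : D.State}
    (hAT : A ⊆ T) (hTB : T ⊆ B) (hT : Nat.card (D.Circle T) = 1) (hne : (B \ A).Nonempty)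
    (H : ∀ c ∈ B \ A, (∀ S, A ⊆ S → S ⊆ B → c ∉ S → ¬ D.Conn S (c, 0) (c, 2)) ∨
      ∀ S, A ⊆ S → S ⊆ B → c ∉ S → D.Conn S (c, 0) (c, 2)) :
    ∃ c ∈ B \ A, ∃ (p o : D.Dart) (W : Set D.Dart),
      D.IsLeaf A B c p o False W ∨ D.IsLeaf A B c p o True W := by
  obtain ⟨c, hc, p, o, hpo, S, hAS, hSB, hbr, hlo, hlive⟩ :=
    exists_leaf hl halt hAT hTB hT hne H
  obtain ⟨hcB, hcA⟩ := Finset.mem_sdiff.1 hc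
  have hmem : ∀ S', A ⊆ S' → S' ⊆ B → (c ∈ S' ↔ c ∈ S) → ∀ d,
      d ∈ {d | D.Conn S p d} ↔ D.Conn S' p d := by
    intro S' hA' hB' hb d
    refine conn_iff_of_agree (fun d' hd' => ?_) d
    by_cases h : d'.1 ∈ B \ A
    · rw [hlive d' hd' h, hb]
    · rw [Finset.mem_sdiff, not_and_not_right] at h
      exact ⟨fun h' => hA' (h (hSB h')), fun h' => hAS (h (hB' h'))⟩
  refine ⟨c, hc, p, o, {d | D.Conn S p d}, ?_⟩
  by_cases hcS : c ∈ S
  · refine Or.inr ⟨hpo, fun S' hA' hB' hb => hmem S' hA' hB' (by simp [hb, hcS]), ?_, hlive⟩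
    intro S' hA' hB' hb
    obtain ⟨R, hR, rfl⟩ : ∃ R, c ∉ R ∧ insert c R = S' :=
      ⟨S'.erase c, Finset.notMem_erase _ _, Finset.insert_erase (hb.2 trivial)⟩
    rw [toggle_insert_self hR]
    refine halt.joins_insert' hR (hlo hcS R (fun x hx => ?_)
      ((Finset.subset_insert _ _).trans hB') hR)
    exact (Finset.mem_insert.1 (hA' hx)).resolve_left fun e => hcA (by rwa [← e])
  · refine Or.inl ⟨hpo, fun S' hA' hB' hb => hmem S' hA' hB' (by simp [hb, hcS]), ?_, hlive⟩
    intro S' hA' hB' hb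
    have hcS' : c ∉ S' := fun h => hb.1 h
    rw [toggle_of_notMem hcS']
    exact halt.joins_insert hcS' (hbr hcS S' hA' hB' hcS')

end Leaf

section Main

theorem qdeg_of_card_circle_eq_one (s : D.Gen) (h : Nat.card (D.Circle s.1) = 1) :
    ∃ z, D.qdeg s = 1 - 2 * ((s.2 z : ℕ) : ℤ) + s.1.card := by
  obtain ⟨_, ⟨z⟩⟩ := Nat.card_eq_one_iff_unique.1 h
  have : Unique (D.Circle s.1) := ⟨⟨z⟩, fun _ => Subsingleton.elim _ _⟩
  exact ⟨default, by rw [qdeg, finsum_unique]⟩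

/-- The complex of a state that consists of one circle. -/
theorem thin_of_card_circle_eq_one (hA : Nat.card (D.Circle A) = 1) :
    D.Thin A.card (D.ivl A A) := by
  classical
  have hQ : ∀ s : D.Gen, s ∈ D.ivl A A ↔ s.1 = A := fun s =>
    ⟨fun h => Finset.Subset.antisymm h.2 h.1, fun h => ⟨h.ge, h.le⟩⟩
  have hd : ∀ s t : D.Gen, s.1 = A → t.1 = A → D.dCoeff s t = 0 := fun s t hs ht => by
    by_contra h
    obtain ⟨x, hx, hxt, -⟩ := dCoeff_ne_zero h
    rw [hs] at hx hxt
    rw [ht] at hxt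
    exact hx (hxt ▸ Finset.mem_insert_self x A)
  have hbd : ∀ i j x, SuppOn D.hdeg D.qdeg (D.ivl A A) i j x → ∀ t ∈ D.ivl A A,
      bd D.dCoeff x t = 0 := fun i j x hx t ht => Finset.sum_eq_zero fun s _ => by
    by_cases hs : x s = 0
    · rw [hs, zero_mul]
    · rw [hd s t ((hQ s).1 (hx s hs).1) ((hQ t).1 ht), mul_zero]
  have key : ∀ i j, ¬ ExactOn D.dCoeff D.hdeg D.qdeg (D.ivl A A) i j ↔
      ∃ s : D.Gen, s.1 = A ∧ D.hdeg s = i ∧ D.qdeg s = j := by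
    intro i j
    constructor
    · intro h
      by_contra hno
      push Not at hno
      refine h fun x hx _ => ⟨0, fun s hs => absurd rfl hs, fun t ht => ?_⟩
      rw [hbd i j 0 (fun s hs => absurd rfl hs) t ht]
      by_contra hne
      obtain ⟨h1, h2, h3⟩ := hx t fun h => hne h.symm
      exact hno t ((hQ t).1 h1) h2 h3
    · rintro ⟨s, hs, h1, h2⟩ h
      have hsupp : SuppOn D.hdeg D.qdeg (D.ivl A A) i j (Pi.single s 1) := fun t ht => by
        obtain rfl : t = s := by
          by_contra hne
          exact ht (Pi.single_eq_of_ne hne _)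
        exact ⟨(hQ t).2 hs, h1, h2⟩
      obtain ⟨y, hy, hyx⟩ := h _ hsupp (hbd _ _ _ hsupp)
      have := hyx s ((hQ s).2 hs)
      rw [hbd _ _ y hy s ((hQ s).2 hs), Pi.single_eq_same] at this
      exact zero_ne_one this
  refine ⟨A.card, A.card, fun i j h => ?_, ?_, ?_⟩
  · obtain ⟨s, hs, h1, h2⟩ := (key i j).1 h
    obtain ⟨z, hz⟩ := qdeg_of_card_circle_eq_one s (by rwa [hs])
    rw [hdeg, hs] at h1
    rw [hs] at hz
    have := (s.2 z).is_lt
    omega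
  · refine (key _ _).2 ⟨⟨A, fun _ => 1⟩, rfl, rfl, ?_⟩
    obtain ⟨z, hz⟩ := qdeg_of_card_circle_eq_one ⟨A, fun _ => 1⟩ hA
    simp only [Fin.val_one] at hz
    rw [hz]
    push_cast
    ring
  · refine (key _ _).2 ⟨⟨A, fun _ => 0⟩, rfl, rfl, ?_⟩
    obtain ⟨z, hz⟩ := qdeg_of_card_circle_eq_one ⟨A, fun _ => 0⟩ hA
    simp only [Fin.val_zero] at hz
    rw [hz]
    push_cast
    ring

theorem thin_ivl (hl : D.loops = 0) (halt : D.IsAlternating) {m : ℕ}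
    (hm : ∀ T : D.State, Nat.card (D.Circle T) = 1 → T.card = m) (k : ℕ) :
    ∀ A B T : D.State, (B \ A).card = k → A ⊆ T → T ⊆ B → Nat.card (D.Circle T) = 1 →
      D.Thin m (D.ivl A B) := by
  have hM := isDiff hl halt
  induction k with
  | zero =>
    intro A B T hk hAT hTB hT
    have hBA : B ⊆ A := by rwa [Finset.card_eq_zero, Finset.sdiff_eq_empty_iff_subset] at hk
    obtain rfl : A = B := Finset.Subset.antisymm (hAT.trans hTB) hBA
    obtain rfl : A = T := Finset.Subset.antisymm hAT hTB
    rw [← hm A hT]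
    exact thin_of_card_circle_eq_one hT
  | succ k ih =>
    intro A B T hk hAT hTB hT
    have h1 : ∀ c ∈ B \ A, (B \ insert c A).card = k := fun c hc => by
      rw [Finset.sdiff_insert, Finset.card_erase_of_mem hc, hk]
      rfl
    have h0 : ∀ c ∈ B \ A, (B.erase c \ A).card = k := fun c hc => by
      rw [Finset.erase_sdiff_comm, Finset.card_erase_of_mem hc, hk]
      rfl
    have hne : (B \ A).Nonempty := Finset.card_pos.1 (by omega)
    by_cases hgen : ∃ c ∈ B \ A,
        (∃ T, A ⊆ T ∧ T ⊆ B ∧ Nat.card (D.Circle T) = 1 ∧ c ∈ T) ∧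
        ∃ T, A ⊆ T ∧ T ⊆ B ∧ Nat.card (D.Circle T) = 1 ∧ c ∉ T
    · obtain ⟨c, hc, ⟨T₁, g1, g2, g3, g4⟩, ⟨T₀, f1, f2, f3, f4⟩⟩ := hgen
      exact Thin.of_splits hM (splits_ivl A B c)
        (ih _ _ T₁ (h1 c hc) (Finset.insert_subset g4 g1) g2 g3)
        (ih _ _ T₀ (h0 c hc) f1 (Finset.subset_erase.2 ⟨f2, f4⟩) f3)
    · push Not at hgen
      have hdich : ∀ c ∈ B \ A, (∀ S, A ⊆ S → S ⊆ B → c ∉ S → ¬ D.Conn S (c, 0) (c, 2)) ∨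
          ∀ S, A ⊆ S → S ⊆ B → c ∉ S → D.Conn S (c, 0) (c, 2) := by
        intro c hc
        obtain ⟨hcB, hcA⟩ := Finset.mem_sdiff.1 hc
        by_cases hcT : c ∈ T
        · exact Or.inl fun S _ hSB hcS => not_conn_of_forall_mem hl halt hAT hTB hT hcA
            (fun T' h1 h2 h3 => hgen c hc ⟨T, hAT, hTB, hT, hcT⟩ T' h1 h2 h3) hSB hcS
        · refine Or.inr fun S hAS _ hcS => conn_of_forall_notMem hl halt hAT hTB hT hcB
            (fun T' h1 h2 h3 h4 => hcT (hgen c hc ⟨T', h1, h2, h3, h4⟩ T hAT hTB hT)) hAS hcS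
      obtain ⟨c, hc, p, o, W, L | L⟩ := exists_isLeaf hl halt hAT hTB hT hne hdich
      all_goals obtain ⟨hcB, hcA⟩ := Finset.mem_sdiff.1 hc
      · refine L.thin_of_bridge hl hM hcA hcB (ih _ _ T (h1 c hc) ?_ hTB hT)
        refine Finset.insert_subset ?_ hAT
        by_contra hcT
        have := card_circle_insert_of_not_conn hl halt hcT (by
          have J := L.joins T hAT hTB (by simp [hcT])
          exact J.not_conn)
        have := card_circle_pos c (insert c T)
        omega
      · refine L.thin_of_loop hl hM hcA hcB (ih _ _ T (h0 c hc) hAT ?_ hT)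
        refine Finset.subset_erase.2 ⟨hTB, fun hcT => ?_⟩
        have J := L.joins T hAT hTB (by simp [hcT])
        have := card_circle_of_joined hl J.agree J.not_conn J.conn
        have := card_circle_pos c (D.toggle c T)
        omega

theorem d_apply (x : D.Chain) (t : D.Gen) : D.d x t = bd D.dCoeff x t := by
  rw [d, Finsupp.linearCombination_apply, Finsupp.sum_fintype _ _ (by simp), Finsupp.finsetSum_apply]
  rfl

theorem mem_chain_iff {i j : ℤ} {x : D.Chain} :
    x ∈ D.chain i j ↔ SuppOn D.hdeg D.qdeg Set.univ i j x := by
  rw [chain, Finsupp.mem_supported']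
  refine forall_congr' fun s => ?_
  simp only [Set.mem_ofPred_eq, Set.mem_univ, true_and]
  tauto

theorem nontrivial_H_iff (i j : ℤ) :
    Nontrivial (D.H i j) ↔ ¬ ExactOn D.dCoeff D.hdeg D.qdeg Set.univ i j := by
  rw [H, Submodule.Quotient.nontrivial_iff, not_iff_not, Submodule.submoduleOf,
    Submodule.comap_subtype_eq_top]
  constructor
  · intro h x hx hdx
    have hmem : Finsupp.equivFunOnFinite.symm x ∈ D.cycles i j := by
      refine ⟨mem_chain_iff.2 hx, ?_⟩
      refine LinearMap.mem_ker.2 ?_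
      ext t
      rw [d_apply]
      exact hdx t trivial
    obtain ⟨y, hy, hyx⟩ := h hmem
    refine ⟨y, mem_chain_iff.1 hy, fun t _ => ?_⟩
    rw [← d_apply, hyx]
    rfl
  · rintro h x ⟨hx, hdx⟩
    obtain ⟨y, hy, hyx⟩ := h x (mem_chain_iff.1 hx) fun t _ => by
      rw [← d_apply, LinearMap.mem_ker.1 hdx]
      rfl
    refine ⟨Finsupp.equivFunOnFinite.symm y, mem_chain_iff.2 hy, ?_⟩
    ext t
    rw [d_apply]
    exact hyx t trivial

theorem ivl_empty_univ : D.ivl ∅ Finset.univ = Set.univ := by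
  ext s
  simp [ivl]

theorem IsKnot.thin_univ (hknot : D.IsKnot) (halt : D.IsAlternating) :
    ∃ m : ℕ, (∃ T : D.State, Nat.card (D.Circle T) = 1) ∧
      (∀ T : D.State, Nat.card (D.Circle T) = 1 → T.card = m) ∧ D.Thin m Set.univ := by
  rw [← ivl_empty_univ]
  rcases Nat.eq_zero_or_pos D.n with hn | hn
  · have : IsEmpty (Fin D.n) := by rw [hn]; infer_instance
    have hT : ∀ T : D.State, T = ∅ := fun T => Finset.eq_empty_of_isEmpty T
    have h1 : Nat.card (D.Circle ∅) = 1 := by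
      have e1 : IsEmpty (Quot fun d d' : D.Dart => d' = D.edge d ∨ d' = D.opp d) :=
        ⟨fun z => (Quot.exists_rep z).elim fun d _ => isEmptyElim d.1⟩
      have e2 : IsEmpty (Quot fun d d' : D.Dart => d' = D.edge d ∨ d' = D.smooth ∅ d) :=
        ⟨fun z => (Quot.exists_rep z).elim fun d _ => isEmptyElim d.1⟩
      have h := hknot.card_eq
      rw [Nat.card_of_isEmpty, zero_add] at h
      unfold Circle
      rw [Nat.card_sum, Nat.card_of_isEmpty, zero_add, Nat.card_eq_fintype_card, Fintype.card_fin, h]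
    refine ⟨0, ⟨∅, h1⟩, fun T _ => by rw [hT T]; rfl, ?_⟩
    rw [hT Finset.univ]
    exact thin_of_card_circle_eq_one h1
  · have hl := hknot.loops_eq_zero ⟨0, hn⟩
    obtain ⟨T, hT⟩ := hknot.exists_card_circle_eq_one halt ⟨0, hn⟩
    have hm : ∀ T' : D.State, Nat.card (D.Circle T') = 1 → T'.card = T.card := fun T' hT' => by
      have e1 := card_of_card_circle_eq_one hl halt ⟨0, hn⟩ hT
      have e2 := card_of_card_circle_eq_one hl halt ⟨0, hn⟩ hT'
      omega
    exact ⟨T.card, ⟨T, hT⟩, hm, thin_ivl hl halt hm _ _ _ T rfl (Finset.empty_subset _)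
      (Finset.subset_univ _) hT⟩

end Main

end LinkDiagram

theorem theorem3p2 (D : LinkDiagram) (hknot : D.IsKnot) (halt : D.IsAlternating) :
    ∃ n₁ : ℕ, (D.statesWith 1).Nonempty ∧ (∀ S ∈ D.statesWith 1, S.card = n₁) ∧
      ∃ iMin iMax : ℤ, IsLeast D.homSupport iMin ∧ IsGreatest D.homSupport iMax ∧
        Nontrivial (D.H iMin (2 * iMin - n₁ - 1)) ∧
        Nontrivial (D.H iMax (2 * iMax - n₁ + 1)) := by
  obtain ⟨m, hne, hm, a, b, h, hl, hu⟩ := hknot.thin_univ halt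
  rw [← LinkDiagram.nontrivial_H_iff] at hl hu
  refine ⟨m, hne, hm, a, b, ⟨⟨_, hl⟩, ?_⟩, ⟨⟨_, hu⟩, ?_⟩, hl, hu⟩
  · rintro i ⟨j, hij⟩
    exact (h i j ((LinkDiagram.nontrivial_H_iff i j).1 hij)).1
  · rintro i ⟨j, hij⟩
    exact (h i j ((LinkDiagram.nontrivial_H_iff i j).1 hij)).2.1
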